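/- Let $X$ be a closed $C^\infty$ manifold with tangent bundle $\pi_X\colon TX\to X$, and fix a smooth linear connection on $TX$ (for example the Levi-Civita connection of a Riemannian metric). For a tangent vector $w\in T(TX)$ of the manifold $TX$ let $w_0=\pi_0(w)\in TX$ be the point from which it emanates, let $w_h=\pi_1(w)=d\pi_X(w)$ be its horizontal component and let $w_v$ be its vertical component with respect to the connection; all three are vectors in $T_xX$, where $x=\pi_X(w_0)$. Then $T(TX)$, with its usual topology, is a complex vector bundle over $TX$ in two ways: via $\pi_0\colon T(TX)\to TX$, the fibre at $w_0\in T_xX$ being identified with $T_xX\otimes\mathbb C$ by $w\mapsto w_v+i\,w_h$; and via $\pi_1=d\pi_X\colon T(TX)\to TX$, the fibre at $w_h\in T_xX$ being identified with $T_xX\otimes\mathbb C$ by $w\mapsto w_0+i\,w_v$. For a locally compact space $Y$ let $K^0(Y)$ be topological $K$-theory with compact supports. Its elements are represented by triples $(\sigma,E,F)$, where $\sigma\colon E\to F$ is a map of complex vector bundles on $Y$ which is an isomorphism outside a compact set. For $j=0,1$ let $W_j$ be the complex vector bundle $\pi_j\colon T(TX)\to TX$, and let $\tau_j\colon\pi_j^*\Lambda^{even}W_j\to\pi_j^*\Lambda^{odd}W_j$,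 $\tau_j(w)=\wedge_w+\iota_w$, be its Thom class, where $\iota_w$ is the adjoint of exterior multiplication $\wedge_w$ for some hermitian structure on $W_j$. For a triple $(\sigma,E,F)$ on $TX$ let $\pi_j^*\sigma\otimes\tau_j$ be the bundle map $$\begin{pmatrix}\pi_j^*\sigma\otimes 1&-1\otimes\tau_j^*\\ 1\otimes\tau_j&\pi_j^*\sigma^*\otimes 1\end{pmatrix}\colon\ \pi_j^*E\otimes\pi_j^*\Lambda^{even}W_j\,\oplus\,\pi_j^*F\otimes\pi_j^*\Lambda^{odd}W_j\ \longrightarrow\ \pi_j^*F\otimes\pi_j^*\Lambda^{even}W_j\,\oplus\,\pi_j^*E\otimes\pi_j^*\Lambda^{odd}W_j ,$$ where adjoints are taken with respect to hermitian structures. This bundle map is an isomorphism outside a compact subset of $T(TX)$, and for each $j$ there is exactly one group homomorphism $K^0(TX)\to K^0(T(TX))$ with $[\sigma]\mapsto[\pi_j^*\sigma\otimes\tau_j]$ for all triples and all choices of hermitian structures (the Thom map of $W_j$). The two Thom maps coincide: $$[\pi_0^*\sigma\otimes\tau_0]=[\pi_1^*\sigma\otimes\tau_1]\quad\text{in } K^0(T(TX))\qquad\text{for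 every } [\sigma]\in K^0(TX).$$ -/

import Mathlib

open scoped Manifold ContDiff TensorProduct

universe u

/-! ## Complex vector bundles -/

/-- A (topological, finite rank) complex vector bundle on `Y`: a family of complex vector spaces
with an atlas of local trivializations whose transition functions are continuous.  The trivialization
indexed by `i : Y` is defined over the open neighbourhood `base i` of `i`; it is given by
the mutually inverse linear maps `toModel i y : Fib y → ℂ ^ rk i`, `ofModel i y : ℂ ^ rk i → Fib y`
for `y ∈ base i` (the values for `y ∉ base i` carry no meaning).  The rank is locally constant, it
need not be constant. -/
structure CVB (Y : Type u) [TopologicalSpace Y] : Type (max u 1) where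
  Fib : Y → Type
  [addCommGroup : ∀ y, AddCommGroup (Fib y)]
  [module : ∀ y, Module ℂ (Fib y)]
  base : Y → Set Y
  rk : Y → ℕ
  toModel : ∀ i y, Fib y →ₗ[ℂ] (Fin (rk i) → ℂ)
  ofModel : ∀ i y, (Fin (rk i) → ℂ) →ₗ[ℂ] Fib y
  isOpen_base : ∀ i, IsOpen (base i)
  mem_base : ∀ i, i ∈ base i
  ofModel_toModel : ∀ i, ∀ y ∈ base i, ∀ v, ofModel i y (toModel i y v) = v
  toModel_ofModel : ∀ i, ∀ y ∈ base i, ∀ m, toModel i y (ofModel i y m) = m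
  continuousOn_transition : ∀ i j m,
    ContinuousOn (fun y => toModel j y (ofModel i y m)) (base i ∩ base j)

attribute [instance] CVB.addCommGroup CVB.module

/-- Weak continuity of a map into a finite dimensional complex vector space (helper). -/
def WCont {Y : Type*} [TopologicalSpace Y] {M : Type*} [AddCommGroup M] [Module ℂ M]
    (f : Y → M) (S : Set Y) : Prop :=
  ∀ φ : M →ₗ[ℂ] ℂ, ContinuousOn (fun y => φ (f y)) S

theorem WCont.of_continuousOn {Y : Type*} [TopologicalSpace Y] {k : ℕ} {f : Y → Fin k → ℂ}
    {S : Set Y} (h : ContinuousOn f S) : WCont f S := fun φ =>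
  (LinearMap.continuous_of_finiteDimensional φ).comp_continuousOn h

theorem WCont.map {Y : Type*} [TopologicalSpace Y] {M N : Type*} [AddCommGroup M] [Module ℂ M]
    [AddCommGroup N] [Module ℂ N] {f : Y → M} {S : Set Y} (h : WCont f S) (L : M →ₗ[ℂ] N) :
    WCont (fun y => L (f y)) S := fun φ => h (φ ∘ₗ L)

theorem WCont.bilin {Y : Type*} [TopologicalSpace Y] {M N P : Type*} [AddCommGroup M] [Module ℂ M]
    [AddCommGroup N] [Module ℂ N] [AddCommGroup P] [Module ℂ P] [FiniteDimensional ℂ M]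
    {f : Y → M} {g : Y → N} {S : Set Y} (hf : WCont f S) (hg : WCont g S)
    (B : M →ₗ[ℂ] N →ₗ[ℂ] P) : WCont (fun y => B (f y) (g y)) S := by
  intro φ
  have key : ∀ y, φ (B (f y) (g y)) =
      ∑ k, (Module.finBasis ℂ M).coord k (f y) * φ (B (Module.finBasis ℂ M k) (g y)) := by
    intro y
    conv_lhs => rw [← (Module.finBasis ℂ M).sum_repr (f y)]
    rw [map_sum, LinearMap.sum_apply, map_sum]
    exact Finset.sum_congr rfl fun k _ => by
      rw [map_smul, LinearMap.smul_apply, map_smul, smul_eq_mul, Module.Basis.coord_apply]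
  simp only [key]
  exact continuousOn_finsetSum _ fun k _ =>
    (hf ((Module.finBasis ℂ M).coord k)).mul (hg (φ ∘ₗ B (Module.finBasis ℂ M k)))

namespace CVB

/-- A bundle whose trivializations take values in arbitrary finite dimensional vector spaces
`M i`; these are identified with `ℂ ^ dim (M i)` by a choice of bases. -/
noncomputable def ofModels {Y : Type u} [TopologicalSpace Y] (Fib : Y → Type)
    [∀ y, AddCommGroup (Fib y)] [∀ y, Module ℂ (Fib y)] (base : Y → Set Y)
    (M : Y → Type) [∀ i, AddCommGroup (M i)] [∀ i, Module ℂ (M i)]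
    [∀ i, FiniteDimensional ℂ (M i)]
    (toM : ∀ i y, Fib y →ₗ[ℂ] M i) (ofM : ∀ i y, M i →ₗ[ℂ] Fib y)
    (isOpen_base : ∀ i, IsOpen (base i)) (mem_base : ∀ i, i ∈ base i)
    (ofM_toM : ∀ i, ∀ y ∈ base i, ∀ v, ofM i y (toM i y v) = v)
    (toM_ofM : ∀ i, ∀ y ∈ base i, ∀ m, toM i y (ofM i y m) = m)
    (wcont : ∀ i j m, WCont (fun y => toM j y (ofM i y m)) (base i ∩ base j)) : CVB Y where
  Fib := Fib
  base := base
  rk i := Module.finrank ℂ (M i)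
  toModel i y := (Module.finBasis ℂ (M i)).equivFun.toLinearMap ∘ₗ toM i y
  ofModel i y := ofM i y ∘ₗ (Module.finBasis ℂ (M i)).equivFun.symm.toLinearMap
  isOpen_base := isOpen_base
  mem_base := mem_base
  ofModel_toModel i y hy v := by
    change ofM i y ((Module.finBasis ℂ (M i)).equivFun.symm
      ((Module.finBasis ℂ (M i)).equivFun (toM i y v))) = v
    rw [LinearEquiv.symm_apply_apply, ofM_toM i y hy]
  toModel_ofModel i y hy m := by
    change (Module.finBasis ℂ (M i)).equivFun
      (toM i y (ofM i y ((Module.finBasis ℂ (M i)).equivFun.symm m))) = m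
    rw [toM_ofM i y hy, LinearEquiv.apply_symm_apply]
  continuousOn_transition i j m := by
    refine continuousOn_pi.2 fun k => ?_
    exact wcont i j ((Module.finBasis ℂ (M i)).equivFun.symm m)
      ((Module.finBasis ℂ (M j)).coord k)

variable {Y : Type u} [TopologicalSpace Y]

theorem wcont_transition (E : CVB Y) (i j : Y) (m : Fin (E.rk i) → ℂ) :
    WCont (fun y => E.toModel j y (E.ofModel i y m)) (E.base i ∩ E.base j) :=
  WCont.of_continuousOn (E.continuousOn_transition i j m)

/-- The pull-back `f^*E`; its fibre at `z` is the fibre of `E` at `f z`. -/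
def pullback {Z : Type u} [TopologicalSpace Z] (f : Z → Y) (hf : Continuous f) (E : CVB Y) :
    CVB Z where
  Fib z := E.Fib (f z)
  base i := f ⁻¹' E.base (f i)
  rk i := E.rk (f i)
  toModel i z := E.toModel (f i) (f z)
  ofModel i z := E.ofModel (f i) (f z)
  isOpen_base i := (E.isOpen_base (f i)).preimage hf
  mem_base i := E.mem_base (f i)
  ofModel_toModel i z hz v := E.ofModel_toModel (f i) (f z) hz v
  toModel_ofModel i z hz m := E.toModel_ofModel (f i) (f z) hz m
  continuousOn_transition i j m :=
    (E.continuousOn_transition (f i) (f j) m).comp hf.continuousOn fun _ hz => hz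

/-- The direct sum `E ⊕ F`. -/
noncomputable def sum (E F : CVB Y) : CVB Y :=
  ofModels (fun y => E.Fib y × F.Fib y) (fun i => E.base i ∩ F.base i)
    (fun i => (Fin (E.rk i) → ℂ) × (Fin (F.rk i) → ℂ))
    (fun i y => (E.toModel i y).prodMap (F.toModel i y))
    (fun i y => (E.ofModel i y).prodMap (F.ofModel i y))
    (fun i => (E.isOpen_base i).inter (F.isOpen_base i))
    (fun i => ⟨E.mem_base i, F.mem_base i⟩)
    (fun i y hy v => Prod.ext (E.ofModel_toModel i y hy.1 v.1) (F.ofModel_toModel i y hy.2 v.2))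
    (fun i y hy m => Prod.ext (E.toModel_ofModel i y hy.1 m.1) (F.toModel_ofModel i y hy.2 m.2))
    (by
      intro i j m φ
      have h1 := (E.wcont_transition i j m.1) (φ ∘ₗ LinearMap.inl ℂ _ _)
      have h2 := (F.wcont_transition i j m.2) (φ ∘ₗ LinearMap.inr ℂ _ _)
      refine ((h1.mono fun y hy => ⟨hy.1.1, hy.2.1⟩).add
        (h2.mono fun y hy => ⟨hy.1.2, hy.2.2⟩)).congr fun y _ => ?_
      simp [← map_add])

/-- The tensor product `E ⊗ F`. -/
noncomputable def tensor (E F : CVB Y) : CVB Y :=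
  ofModels (fun y => E.Fib y ⊗[ℂ] F.Fib y) (fun i => E.base i ∩ F.base i)
    (fun i => (Fin (E.rk i) → ℂ) ⊗[ℂ] (Fin (F.rk i) → ℂ))
    (fun i y => TensorProduct.map (E.toModel i y) (F.toModel i y))
    (fun i y => TensorProduct.map (E.ofModel i y) (F.ofModel i y))
    (fun i => (E.isOpen_base i).inter (F.isOpen_base i))
    (fun i => ⟨E.mem_base i, F.mem_base i⟩)
    (fun i y hy v => by
      induction v with
      | zero => simp
      | tmul a b => simp [E.ofModel_toModel i y hy.1, F.ofModel_toModel i y hy.2]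
      | add a b ha hb => rw [map_add, map_add, ha, hb])
    (fun i y hy v => by
      induction v with
      | zero => simp
      | tmul a b => simp [E.toModel_ofModel i y hy.1, F.toModel_ofModel i y hy.2]
      | add a b ha hb => rw [map_add, map_add, ha, hb])
    (by
      intro i j m φ
      induction m with
      | zero => simpa using continuousOn_const
      | tmul a b =>
        have h1 : WCont _ (E.base i ∩ F.base i ∩ (E.base j ∩ F.base j)) := fun ψ =>
          ((E.wcont_transition i j a) ψ).mono fun y hy => ⟨hy.1.1, hy.2.1⟩
        have h2 : WCont _ (E.base i ∩ F.base i ∩ (E.base j ∩ F.base j)) := fun ψ =>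
          ((F.wcont_transition i j b) ψ).mono fun y hy => ⟨hy.1.2, hy.2.2⟩
        exact h1.bilin h2 (TensorProduct.mk ℂ _ _) φ
      | add a b ha hb => 
        refine (ha.add hb).congr fun y _ => ?_
        simp only [map_add, Pi.add_apply])

end CVB

/-! ## Exterior algebras -/

/-- The even (`i = 0`) or odd (`i = 1`) part of the exterior algebra of `V`. -/
abbrev ExtPart (V : Type*) [AddCommGroup V] [Module ℂ V] (i : ZMod 2) :
    Submodule ℂ (ExteriorAlgebra ℂ V) :=
  CliffordAlgebra.evenOdd (0 : QuadraticForm ℂ V) i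

theorem ExtPart.map_le {V W : Type*} [AddCommGroup V] [Module ℂ V] [AddCommGroup W] [Module ℂ W]
    (f : V →ₗ[ℂ] W) (i : ZMod 2) (x : ExteriorAlgebra ℂ V) (hx : x ∈ ExtPart V i) :
    ExteriorAlgebra.map f x ∈ ExtPart W i := by
  have : (ExtPart V i).map (ExteriorAlgebra.map f).toLinearMap ≤ ExtPart W i := by
    simp only [ExtPart, CliffordAlgebra.evenOdd, Submodule.map_iSup]
    refine iSup_mono fun j => ?_
    rw [Submodule.map_pow]
    refine pow_le_pow_left' ?_ _
    rintro _ ⟨_, ⟨v, rfl⟩, rfl⟩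
    exact ⟨f v, (ExteriorAlgebra.map_apply_ι f v).symm⟩
  exact this ⟨x, hx, rfl⟩

/-- The map `Λ^{ev/odd} V → Λ^{ev/odd} W` induced by a linear map `V → W`. -/
noncomputable def ExtPart.map {V W : Type*} [AddCommGroup V] [Module ℂ V] [AddCommGroup W]
    [Module ℂ W] (f : V →ₗ[ℂ] W) (i : ZMod 2) : ExtPart V i →ₗ[ℂ] ExtPart W i :=
  (ExteriorAlgebra.map f).toLinearMap.restrict (ExtPart.map_le f i)

instance ExteriorAlgebra.finiteDimensional_complex (V : Type*) [AddCommGroup V] [Module ℂ V]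
    [FiniteDimensional ℂ V] : FiniteDimensional ℂ (ExteriorAlgebra ℂ V) := by
  have htop : (⨆ k : ℕ, ⋀[ℂ]^k V) = ⊤ :=
    (DirectSum.Decomposition.isInternal (fun k : ℕ => ⋀[ℂ]^k V)).submodule_iSup_eq_top
  have hle : (⨆ k : ℕ, ⋀[ℂ]^k V) ≤ ⨆ k : Fin (Module.finrank ℂ V + 1), ⋀[ℂ]^(k : ℕ) V := by
    refine iSup_le fun k => ?_
    by_cases hk : k < Module.finrank ℂ V + 1
    · exact le_iSup (fun k : Fin (Module.finrank ℂ V + 1) => ⋀[ℂ]^(k : ℕ) V) ⟨k, hk⟩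
    · have h0 : Module.finrank ℂ (⋀[ℂ]^k V) = 0 := by
        rw [exteriorPower.finrank_eq, Nat.choose_eq_zero_of_lt (by omega)]
      rw [Submodule.finrank_eq_zero.1 h0]
      exact bot_le
  have : FiniteDimensional ℂ (⊤ : Submodule ℂ (ExteriorAlgebra ℂ V)) := by
    rw [← top_le_iff.1 (htop ▸ hle)]
    infer_instance
  exact Module.finite_def.2 (Submodule.fg_top _ |>.1 (Module.finite_def.1 this))

theorem WCont.extMap {Y : Type*} [TopologicalSpace Y] {V W : Type*} [AddCommGroup V] [Module ℂ V]
    [AddCommGroup W] [Module ℂ W] [FiniteDimensional ℂ W] {t : Y → V →ₗ[ℂ] W} {S : Set Y}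
    (h : ∀ v, WCont (fun y => t y v) S) (x : ExteriorAlgebra ℂ V) :
    WCont (fun y => ExteriorAlgebra.map (t y) x) S := by
  induction x using ExteriorAlgebra.induction with
  | algebraMap r =>
    intro φ
    simpa using continuousOn_const
  | ι v =>
    simpa using (h v).map (ExteriorAlgebra.ι ℂ)
  | mul a b ha hb =>
    simpa using ha.bilin hb (LinearMap.mul ℂ _)
  | add a b ha hb =>
    intro φ
    refine ((ha φ).add (hb φ)).congr fun y _ => ?_
    simp only [map_add, Pi.add_apply]

/-- The even (`i = 0`) or odd (`i = 1`) part `Λ^{ev/odd} F` of the exterior algebra bundle. -/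
noncomputable def CVB.ext {Y : Type u} [TopologicalSpace Y] (F : CVB Y) (i : ZMod 2) : CVB Y :=
  CVB.ofModels (fun y => ExtPart (F.Fib y) i) F.base (fun k => ExtPart (Fin (F.rk k) → ℂ) i)
    (fun k y => ExtPart.map (F.toModel k y) i) (fun k y => ExtPart.map (F.ofModel k y) i)
    F.isOpen_base F.mem_base
    (fun k y hy v => by
      have : F.ofModel k y ∘ₗ F.toModel k y = LinearMap.id :=
        LinearMap.ext (F.ofModel_toModel k y hy)
      refine Subtype.ext ?_
      change ((ExteriorAlgebra.map (F.ofModel k y)).comp (ExteriorAlgebra.map (F.toModel k y))) v.1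
        = v.1
      rw [ExteriorAlgebra.map_comp_map, this, ExteriorAlgebra.map_id, AlgHom.id_apply])
    (fun k y hy v => by
      have : F.toModel k y ∘ₗ F.ofModel k y = LinearMap.id :=
        LinearMap.ext (F.toModel_ofModel k y hy)
      refine Subtype.ext ?_
      change ((ExteriorAlgebra.map (F.toModel k y)).comp (ExteriorAlgebra.map (F.ofModel k y))) v.1
        = v.1
      rw [ExteriorAlgebra.map_comp_map, this, ExteriorAlgebra.map_id, AlgHom.id_apply])
    (by
      intro k l m φ
      obtain ⟨ψ, hψ⟩ := LinearMap.exists_extend φ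
      have := WCont.extMap (t := fun y => F.toModel l y ∘ₗ F.ofModel k y)
        (F.wcont_transition k l) m.1 ψ
      refine this.congr fun y _ => ?_
      simp only [← hψ, ← ExteriorAlgebra.map_comp_map]
      rfl)

/-! ## Maps of vector bundles and K-theory with compact supports -/

namespace CVB

variable {Y : Type u} [TopologicalSpace Y]

/-- Continuity of a fibrewise linear map `E → F`, tested in the local trivializations. -/
def IsCont (E F : CVB Y) (f : ∀ y, E.Fib y →ₗ[ℂ] F.Fib y) : Prop :=
  ∀ i j m, ContinuousOn (fun y => F.toModel j y (f y (E.ofModel i y m))) (E.base i ∩ F.base j)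

/-- `σ : E → F` is a continuous vector bundle map which is an isomorphism outside a compact set. -/
def IsSymbol (E F : CVB Y) (σ : ∀ y, E.Fib y →ₗ[ℂ] F.Fib y) : Prop :=
  IsCont E F σ ∧ ∃ C : Set Y, IsCompact C ∧ ∀ y, y ∉ C → Function.Bijective (σ y)

end CVB

/-- A triple `(σ, E, F)`: complex vector bundles `E`, `F` on `Y` and a vector bundle map
`σ : E → F` which is an isomorphism outside a compact set. -/
structure Triple (Y : Type u) [TopologicalSpace Y] : Type (max u 1) where
  E : CVB Y
  F : CVB Y
  σ : ∀ y, E.Fib y →ₗ[ℂ] F.Fib y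
  isSymbol : CVB.IsSymbol E F σ

namespace Triple

variable {Y : Type u} [TopologicalSpace Y]

/-- Isomorphism of triples: isomorphisms of bundles intertwining the bundle maps. -/
def Iso (S T : Triple Y) : Prop :=
  ∃ (a : ∀ y, S.E.Fib y ≃ₗ[ℂ] T.E.Fib y) (b : ∀ y, S.F.Fib y ≃ₗ[ℂ] T.F.Fib y),
    CVB.IsCont S.E T.E (fun y => (a y).toLinearMap) ∧
    CVB.IsCont S.F T.F (fun y => (b y).toLinearMap) ∧
    ∀ y v, b y (S.σ y v) = T.σ y (a y v)

/-- The restriction of a triple on `Y × [0,1]` to `Y × {t}`. -/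
def slice (H : Triple (Y × unitInterval)) (t : unitInterval) : Triple Y where
  E := H.E.pullback (fun y => (y, t)) (by fun_prop)
  F := H.F.pullback (fun y => (y, t)) (by fun_prop)
  σ y := H.σ (y, t)
  isSymbol := by
    refine ⟨fun i j m => ?_, ?_⟩
    · have hc : ContinuousOn (fun y : Y => (y, t)) Set.univ := by fun_prop
      exact (H.isSymbol.1 (i, t) (j, t) m).comp (hc.mono (Set.subset_univ _)) fun _ hy => hy
    · obtain ⟨C, hC, h⟩ := H.isSymbol.2
      exact ⟨Prod.fst '' C, hC.image continuous_fst,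
        fun y hy => h (y, t) fun hyt => hy ⟨(y, t), hyt, rfl⟩⟩

/-- The direct sum of two triples. -/
noncomputable def sum (S T : Triple Y) : Triple Y where
  E := S.E.sum T.E
  F := S.F.sum T.F
  σ y := (S.σ y).prodMap (T.σ y)
  isSymbol := by
    refine ⟨fun i j m => ?_, ?_⟩
    · refine continuousOn_pi.2 fun k => ?_
      have h1 : WCont _ _ := WCont.of_continuousOn (S.isSymbol.1 i j
        (((Module.finBasis ℂ ((Fin (S.E.rk i) → ℂ) × (Fin (T.E.rk i) → ℂ))).equivFun.symm m).1))
      have h2 : WCont _ _ := WCont.of_continuousOn (T.isSymbol.1 i j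
        (((Module.finBasis ℂ ((Fin (S.E.rk i) → ℂ) × (Fin (T.E.rk i) → ℂ))).equivFun.symm m).2))
      let φ := (Module.finBasis ℂ ((Fin (S.F.rk j) → ℂ) × (Fin (T.F.rk j) → ℂ))).coord k
      refine (((h1 (φ ∘ₗ LinearMap.inl ℂ _ _)).mono fun y hy => ⟨hy.1.1, hy.2.1⟩).add
        ((h2 (φ ∘ₗ LinearMap.inr ℂ _ _)).mono fun y hy => ⟨hy.1.2, hy.2.2⟩)).congr fun y _ => ?_
      simp only [LinearMap.comp_apply, ← map_add, LinearMap.inl_apply, LinearMap.inr_apply,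
        Prod.mk_add_mk, add_zero, zero_add, Pi.add_apply]
      rfl
    · obtain ⟨C, hC, h⟩ := S.isSymbol.2
      obtain ⟨D, hD, h'⟩ := T.isSymbol.2
      refine ⟨C ∪ D, hC.union hD, fun y hy => ?_⟩
      exact (h y fun hc => hy (Or.inl hc)).prodMap (h' y fun hc => hy (Or.inr hc))

end Triple

/-- The relations defining `K⁰(Y)`: isomorphic triples are equal, homotopic triples are equal,
the sum is the direct sum, and triples whose bundle map is an isomorphism everywhere are zero. -/
inductive K0Rel (Y : Type u) [TopologicalSpace Y] : FreeAbelianGroup (Triple Y) → Prop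
  | iso (S T : Triple Y) (h : S.Iso T) :
      K0Rel Y (FreeAbelianGroup.of S - FreeAbelianGroup.of T)
  | homotopy (H : Triple (Y × unitInterval)) :
      K0Rel Y (FreeAbelianGroup.of (H.slice 0) - FreeAbelianGroup.of (H.slice 1))
  | sum (S T : Triple Y) :
      K0Rel Y (FreeAbelianGroup.of (S.sum T) - (FreeAbelianGroup.of S + FreeAbelianGroup.of T))
  | acyclic (S : Triple Y) (h : ∀ y, Function.Bijective (S.σ y)) :
      K0Rel Y (FreeAbelianGroup.of S)

/-- Topological K-theory with compact supports `K⁰(Y)` of a locally compact Hausdorff space `Y`. -/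
abbrev K0 (Y : Type u) [TopologicalSpace Y] : Type (max u 1) :=
  FreeAbelianGroup (Triple Y) ⧸ AddSubgroup.closure {x | K0Rel Y x}

/-- The class `[σ, E, F] ∈ K⁰(Y)`. -/
def K0.mk {Y : Type u} [TopologicalSpace Y] (S : Triple Y) : K0 Y :=
  QuotientAddGroup.mk (FreeAbelianGroup.of S)

/-! ## Hermitian structures and adjoints -/

/-- A (continuous) hermitian structure on a complex vector bundle, conjugate linear in the first
variable. -/
structure HermMetric {Y : Type u} [TopologicalSpace Y] (E : CVB Y) where
  form : ∀ y, E.Fib y →ₗ⋆[ℂ] E.Fib y →ₗ[ℂ] ℂ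
  conj_symm : ∀ y v w, starRingEnd ℂ (form y v w) = form y w v
  pos : ∀ y v, v ≠ 0 → 0 < (form y v v).re
  cont : ∀ i m m', ContinuousOn
    (fun y => form y (E.ofModel i y m) (E.ofModel i y m')) (E.base i)

instance CVB.finiteDimensional_fib {Y : Type u} [TopologicalSpace Y] (E : CVB Y) (y : Y) :
    FiniteDimensional ℂ (E.Fib y) :=
  FiniteDimensional.of_injective (E.toModel y y)
    (Function.LeftInverse.injective (E.ofModel_toModel y y (E.mem_base y)))

theorem exists_adjoint {V W : Type*} [AddCommGroup V] [Module ℂ V] [FiniteDimensional ℂ V]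
    [AddCommGroup W] [Module ℂ W] (hV : V →ₗ⋆[ℂ] V →ₗ[ℂ] ℂ)
    (pos : ∀ v, v ≠ 0 → 0 < (hV v v).re) (hW : W →ₗ⋆[ℂ] W →ₗ[ℂ] ℂ) (A : V →ₗ[ℂ] W) :
    ∃ B : W →ₗ[ℂ] V, ∀ w v, hV (B w) v = hW w (A v) := by
  have hinj : Function.Injective hV := by
    refine (injective_iff_map_eq_zero hV).2 fun v hv => ?_
    by_contra h0
    have := pos v h0
    simp [hv] at this
  let D : V →ₗ[ℝ] (V →ₗ[ℂ] ℂ) :=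
    { toFun := hV
      map_add' := map_add hV
      map_smul' := fun r v => by
        have := hV.map_smulₛₗ (r : ℂ) v
        rw [Complex.conj_ofReal] at this
        exact this }
  have : FiniteDimensional ℝ V := FiniteDimensional.complexToReal V
  have : FiniteDimensional ℝ (V →ₗ[ℂ] ℂ) := FiniteDimensional.complexToReal _
  have hrank : Module.finrank ℝ V = Module.finrank ℝ (V →ₗ[ℂ] ℂ) := by
    rw [finrank_real_of_complex, finrank_real_of_complex]
    congr 1
    exact (Subspace.dual_finrank_eq (K := ℂ) (V := V)).symm
  have hsurj : Function.Surjective D :=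
    (LinearMap.injective_iff_surjective_of_finrank_eq_finrank hrank).1 hinj
  choose g hg using hsurj
  have hg' : ∀ f, hV (g f) = f := hg
  refine ⟨⟨⟨fun w => g (hW w ∘ₗ A), fun w w' => ?_⟩, fun c w => ?_⟩, fun w v => ?_⟩
  · apply hinj
    rw [hg', map_add hW, map_add hV, hg', hg', LinearMap.add_comp]
  · apply hinj
    rw [RingHom.id_apply, hg', hW.map_smulₛₗ, hV.map_smulₛₗ, hg', LinearMap.smul_comp]
  · change hV (g (hW w ∘ₗ A)) v = _
    rw [hg', LinearMap.comp_apply]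

/-- The fibrewise adjoint `σ^* : F → E` of `σ : E → F` with respect to hermitian structures, i.e.
the unique map with `⟨σ^* w, v⟩ = ⟨w, σ v⟩`. -/
noncomputable def bundleAdjoint {Y : Type u} [TopologicalSpace Y] {E F : CVB Y}
    (hE : HermMetric E) (hF : HermMetric F) (σ : ∀ y, E.Fib y →ₗ[ℂ] F.Fib y) (y : Y) :
    F.Fib y →ₗ[ℂ] E.Fib y :=
  (exists_adjoint (hE.form y) (hE.pos y) (hF.form y) (σ y)).choose

theorem bundleAdjoint_spec {Y : Type u} [TopologicalSpace Y] {E F : CVB Y}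
    (hE : HermMetric E) (hF : HermMetric F) (σ : ∀ y, E.Fib y →ₗ[ℂ] F.Fib y) (y : Y)
    (w : F.Fib y) (v : E.Fib y) :
    hE.form y (bundleAdjoint hE hF σ y w) v = hF.form y w (σ y v) :=
  (exists_adjoint (hE.form y) (hE.pos y) (hF.form y) (σ y)).choose_spec w v

/-! ## The Thom class and the Thom map -/

theorem contractLeft_mem {V : Type*} [AddCommGroup V] [Module ℂ V] (d : Module.Dual ℂ V)
    (i : ZMod 2) (x : ExteriorAlgebra ℂ V) (hx : x ∈ ExtPart V i) :
    CliffordAlgebra.contractLeft (Q := (0 : QuadraticForm ℂ V)) d x ∈ ExtPart V (i + 1) := by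
  have hmul : ∀ (a : V) (k : ZMod 2) (z : ExteriorAlgebra ℂ V), z ∈ ExtPart V k →
      CliffordAlgebra.ι (0 : QuadraticForm ℂ V) a * z ∈ ExtPart V (k + 1) := fun a k z hz => by
    rw [add_comm]
    exact CliffordAlgebra.evenOdd_mul_le _ 1 k
      (Submodule.mul_mem_mul (CliffordAlgebra.ι_mem_evenOdd_one _ a) hz)
  induction x, hx using CliffordAlgebra.evenOdd_induction with
  | range_ι_pow v h =>
    have hi : i = 0 ∨ i = 1 := (by decide : ∀ i : ZMod 2, i = 0 ∨ i = 1) i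
    rcases hi with rfl | rfl
    · rw [ZMod.val_zero, pow_zero] at h
      obtain ⟨r, rfl⟩ := Submodule.mem_one.1 h
      rw [CliffordAlgebra.contractLeft_algebraMap]
      exact Submodule.zero_mem _
    · rw [ZMod.val_one, pow_one] at h
      obtain ⟨a, rfl⟩ := h
      rw [CliffordAlgebra.contractLeft_ι]
      exact CliffordAlgebra.one_le_evenOdd_zero _ (Submodule.mem_one.2 ⟨_, rfl⟩)
  | add x y hx hy ihx ihy =>
    rw [map_add]
    exact Submodule.add_mem _ ihx ihy
  | ι_mul_ι_mul a b x hx ih =>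
    rw [mul_assoc, CliffordAlgebra.contractLeft_ι_mul, CliffordAlgebra.contractLeft_ι_mul]
    have e : i + 1 + 1 = i := (by decide : ∀ i : ZMod 2, i + 1 + 1 = i) i
    refine Submodule.sub_mem _ (Submodule.smul_mem _ _ (hmul b i x hx)) (hmul a i _ ?_)
    refine Submodule.sub_mem _ (Submodule.smul_mem _ _ hx) ?_
    have := hmul b _ _ ih
    rwa [e] at this

theorem wedge_add_contract_mem {V : Type*} [AddCommGroup V] [Module ℂ V] (v : V)
    (d : Module.Dual ℂ V) (i j : ZMod 2) (hij : j = i + 1) (x : ExteriorAlgebra ℂ V)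
    (hx : x ∈ ExtPart V i) :
    (LinearMap.mulLeft ℂ (ExteriorAlgebra.ι ℂ v) +
      CliffordAlgebra.contractLeft (Q := (0 : QuadraticForm ℂ V)) d) x ∈ ExtPart V j := by
  subst hij
  refine Submodule.add_mem _ ?_ (contractLeft_mem d i x hx)
  rw [LinearMap.mulLeft_apply, add_comm]
  exact CliffordAlgebra.evenOdd_mul_le _ 1 i
    (Submodule.mul_mem_mul (CliffordAlgebra.ι_mem_evenOdd_one _ v) hx)

/-- For a hermitian form `h` on `V` and `v ∈ V`, the map `∧_v + ι_v` from `Λ^i V` to `Λ^j V`, where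
`i, j ∈ {even, odd}` are different.  Here `∧_v` is `α ↦ v ∧ α` and `ι_v` is the contraction with
the linear form `⟨v, ·⟩`, which is the adjoint of `∧_v` for the hermitian structure
induced on `ΛV`; in particular, the maps for `(i, j)` and `(j, i)` are adjoint to each other. -/
noncomputable def thomFib {V : Type*} [AddCommGroup V] [Module ℂ V] (h : V →ₗ⋆[ℂ] V →ₗ[ℂ] ℂ)
    (v : V) (i j : ZMod 2) (hij : j = i + 1) : ExtPart V i →ₗ[ℂ] ExtPart V j :=
  (LinearMap.mulLeft ℂ (ExteriorAlgebra.ι ℂ v) +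
    CliffordAlgebra.contractLeft (Q := (0 : QuadraticForm ℂ V)) (h v)).restrict
    (wedge_add_contract_mem v (h v) i j hij)

/-- The product of `σ : E → F` and `τ : A → B` (with adjoints `σ'`, `τ'`), namely the map
`E ⊗ A ⊕ F ⊗ B → F ⊗ A ⊕ E ⊗ B` with matrix `(σ ⊗ 1, - 1 ⊗ τ'; 1 ⊗ τ, σ' ⊗ 1)`. -/
noncomputable def sharp {E F A B : Type*} [AddCommGroup E] [Module ℂ E] [AddCommGroup F]
    [Module ℂ F] [AddCommGroup A] [Module ℂ A] [AddCommGroup B] [Module ℂ B]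
    (σ : E →ₗ[ℂ] F) (σ' : F →ₗ[ℂ] E) (τ : A →ₗ[ℂ] B) (τ' : B →ₗ[ℂ] A) :
    (E ⊗[ℂ] A) × (F ⊗[ℂ] B) →ₗ[ℂ] (F ⊗[ℂ] A) × (E ⊗[ℂ] B) :=
  LinearMap.prod
    (LinearMap.coprod (TensorProduct.map σ LinearMap.id) (-TensorProduct.map (LinearMap.id : F →ₗ[ℂ] F) τ'))
    (LinearMap.coprod (TensorProduct.map LinearMap.id τ) (TensorProduct.map σ' LinearMap.id))

/-- The structure of a complex vector bundle over `B` on a map `π : Z → B`: a complex vector bundle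
on `B` whose fibre at `b` is identified with `π⁻¹(b)`. -/
structure ComplexBundleOn {Z B : Type u} [TopologicalSpace B] (π : Z → B) where
  bundle : CVB B
  fibEquiv : ∀ b, {z : Z // π z = b} ≃ bundle.Fib b

/-- The tautological section of `π^*Z`: a point `z ∈ Z` seen as a vector in the fibre at `π z`. -/
def ComplexBundleOn.taut {Z B : Type u} [TopologicalSpace B] {π : Z → B} (W : ComplexBundleOn π)
    (z : Z) : W.bundle.Fib (π z) :=
  W.fibEquiv (π z) ⟨z, rfl⟩

/-- The given topology of `Z` is the bundle topology: over the base set of each trivialization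
of the bundle, the trivialization is a homeomorphism `π⁻¹(base i) ≅ base i × ℂ ^ rk i`. -/
def ComplexBundleOn.IsTopological {Z B : Type u} [TopologicalSpace Z] [TopologicalSpace B]
    {π : Z → B} (W : ComplexBundleOn π) : Prop :=
  ∀ i : B, IsHomeomorph fun z : π ⁻¹' W.bundle.base i =>
    ((⟨π z.1, z.2⟩ : W.bundle.base i), W.bundle.toModel i (π z.1) (W.taut z.1))

section Thom

variable {Z B : Type u} [TopologicalSpace Z] [TopologicalSpace B] {π : Z → B} (hπ : Continuous π)
  (W : ComplexBundleOn π)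

/-- The Thom class `τ : π^*Λ^{ev} W → π^*Λ^{odd} W` of the complex vector bundle `W = (π : Z → B)`,
`τ(z) = ∧_z + ι_z` (a family of linear maps over the total space `Z`). -/
noncomputable def thomClass (h : HermMetric W.bundle) (z : Z) :
    ((W.bundle.pullback π hπ).ext 0).Fib z →ₗ[ℂ] ((W.bundle.pullback π hπ).ext 1).Fib z :=
  thomFib (h.form (π z)) (W.taut z) 0 1 (by decide)

/-- The adjoint `∧_z + ι_z : π^*Λ^{odd} W → π^*Λ^{ev} W` of the Thom class. -/
noncomputable def thomClassAdj (h : HermMetric W.bundle) (z : Z) :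
    ((W.bundle.pullback π hπ).ext 1).Fib z →ₗ[ℂ] ((W.bundle.pullback π hπ).ext 0).Fib z :=
  thomFib (h.form (π z)) (W.taut z) 1 0 (by decide)

/-- `π^*E ⊗ Λ^{ev} W ⊕ π^*F ⊗ Λ^{odd} W` -/
noncomputable def thomDom (E F : CVB B) : CVB Z :=
  ((E.pullback π hπ).tensor ((W.bundle.pullback π hπ).ext 0)).sum
    ((F.pullback π hπ).tensor ((W.bundle.pullback π hπ).ext 1))

/-- The bundle map `π^*σ ⊗ τ` from `π^*E ⊗ Λ^{ev} W ⊕ π^*F ⊗ Λ^{odd} W` to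
`π^*F ⊗ Λ^{ev} W ⊕ π^*E ⊗ Λ^{odd} W`. -/
noncomputable def thomProduct (S : Triple B) (hE : HermMetric S.E) (hF : HermMetric S.F)
    (h : HermMetric W.bundle) (z : Z) :
    (thomDom hπ W S.E S.F).Fib z →ₗ[ℂ] (thomDom hπ W S.F S.E).Fib z :=
  sharp (S.σ (π z)) (bundleAdjoint hE hF S.σ (π z)) (thomClass hπ W h z) (thomClassAdj hπ W h z)

/-- `Th : K⁰(B) → K⁰(Z)` is the Thom map `[σ] ↦ [π^*σ ⊗ τ]`: for every triple `(σ, E, F)` and all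
choices of hermitian structures, `π^*σ ⊗ τ` is a continuous bundle map that is an isomorphism
outside a compact set, and `Th` sends the class of `(σ, E, F)` to the class of `π^*σ ⊗ τ`. -/
def IsThomMap (Th : K0 B →+ K0 Z) : Prop :=
  ∀ (S : Triple B) (hE : HermMetric S.E) (hF : HermMetric S.F) (h : HermMetric W.bundle),
    ∃ hs : CVB.IsSymbol (thomDom hπ W S.E S.F) (thomDom hπ W S.F S.E)
        (thomProduct hπ W S hE hF h),
      Th (K0.mk S) = K0.mk
        ⟨thomDom hπ W S.E S.F, thomDom hπ W S.F S.E, thomProduct hπ W S hE hF h, hs⟩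

end Thom

/-! ## The two complex vector bundle structures on `T(TX)` -/

section Tangent

variable {n : ℕ} {X : Type u} [TopologicalSpace X] [ChartedSpace (EuclideanSpace ℝ (Fin n)) X]
  [IsManifold (𝓡 n) ∞ X]

variable (n X) in
/-- The tangent bundle `TX`. -/
abbrev TX : Type u := TangentBundle (𝓡 n) X

variable (n X) in
/-- The tangent bundle `T(TX)` of the manifold `TX`. -/
abbrev TTX : Type u := TangentBundle (𝓡 n).tangent (TX n X)

/-- `π₀ : T(TX) → TX`, the projection of the tangent bundle of the manifold `TX`. -/
def proj0 : TTX n X → TX n X := Bundle.TotalSpace.proj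

/-- `π₁ = dπ_X : T(TX) → TX`, the derivative of `π_X : TX → X`. -/
noncomputable def proj1 : TTX n X → TX n X :=
  tangentMap (𝓡 n).tangent (𝓡 n) (Bundle.TotalSpace.proj : TX n X → X)

theorem continuous_proj0 : Continuous (proj0 : TTX n X → TX n X) :=
  FiberBundle.continuous_proj _ _

theorem continuous_proj1 : Continuous (proj1 : TTX n X → TX n X) :=
  (Bundle.contMDiff_proj (n := ∞) (TangentSpace (𝓡 n) : X → Type)).continuous_tangentMap
    (by exact_mod_cast le_top)

variable (n X) in
/-- A smooth linear connection on `TX`, given by its connection map (vertical projection)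
`K : T(TX) → TX`.  On each `T_p(TX)` it is a linear map to `T_xX`, `x = π_X(p)`, and it restricts to
the canonical identification `T_p^{vert}(TX) ≅ T_xX`, so that it splits the exact sequence
`0 → T_xX → T_p(TX) → T_xX → 0`; it depends smoothly on `p` and is compatible with multiplication
by scalars in the fibres of `TX`. -/
structure LinearConnection where
  K : ∀ p : TX n X, TangentSpace (𝓡 n).tangent p →L[ℝ] TangentSpace (𝓡 n) p.proj
  smooth : ContMDiff (𝓡 n).tangent.tangent (𝓡 n).tangent ∞
    (fun w : TTX n X => (⟨w.proj.proj, K w.proj w.2⟩ : TX n X))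
  vertical : ∀ (x : X) (v u : TangentSpace (𝓡 n) x),
    K ⟨x, v⟩ (mfderiv 𝓘(ℝ, ℝ) (𝓡 n).tangent (fun t : ℝ => (⟨x, v + t • u⟩ : TX n X)) 0 (1 : ℝ))
      = (u : EuclideanSpace ℝ (Fin n))
  homogeneous : ∀ (c : ℝ) (p : TX n X) (w : TangentSpace (𝓡 n).tangent p),
    K ⟨p.proj, c • p.2⟩ (mfderiv (𝓡 n).tangent (𝓡 n).tangent
      (fun q : TX n X => (⟨q.proj, c • q.2⟩ : TX n X)) p w) = c • K p w

theorem proj1_surjective_fib (p : TX n X) (a : TangentSpace (𝓡 n) p.proj) :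
    ∃ w : TangentSpace (𝓡 n).tangent p,
      mfderiv (𝓡 n).tangent (𝓡 n) (Bundle.TotalSpace.proj : TX n X → X) p w = a := by
  obtain ⟨x, v⟩ := p
  let s : ∀ y : X, TangentSpace (𝓡 n) y := FiberBundle.extend (EuclideanSpace ℝ (Fin n)) v
  have hs : MDifferentiableAt (𝓡 n) (𝓡 n).tangent (fun y => (⟨y, s y⟩ : TX n X)) x :=
    FiberBundle.mdifferentiableAt_extend (𝓡 n) _ v
  have hsx : s x = v := FiberBundle.extend_apply_self _ v
  have hp : MDifferentiableAt (𝓡 n).tangent (𝓡 n) (Bundle.TotalSpace.proj : TX n X → X)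
      ⟨x, s x⟩ := Bundle.mdifferentiableAt_proj (TangentSpace (𝓡 n) : X → Type)
  rw [← hsx]
  refine ⟨mfderiv (𝓡 n) (𝓡 n).tangent (fun y => (⟨y, s y⟩ : TX n X)) x a, ?_⟩
  have h := mfderiv_comp x (g := (Bundle.TotalSpace.proj : TX n X → X)) hp hs
  have hid : (Bundle.TotalSpace.proj : TX n X → X) ∘ (fun y => (⟨y, s y⟩ : TX n X)) = id := rfl
  rw [hid, mfderiv_id] at h
  exact (DFunLike.congr_fun h a).symm

theorem mfderiv_proj_vertical (x : X) (v u : TangentSpace (𝓡 n) x) :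
    mfderiv (𝓡 n).tangent (𝓡 n) (Bundle.TotalSpace.proj : TX n X → X) ⟨x, v⟩
      (mfderiv 𝓘(ℝ, ℝ) (𝓡 n).tangent (fun t : ℝ => (⟨x, v + t • u⟩ : TX n X)) 0 (1 : ℝ)) =
      (0 : EuclideanSpace ℝ (Fin n)) := by
  have hd : MDifferentiableAt 𝓘(ℝ, ℝ) (𝓡 n).tangent
      (fun t : ℝ => (⟨x, v + t • u⟩ : TX n X)) 0 := by
    refine (mdifferentiableAt_totalSpace (𝓡 n) _).2 ⟨mdifferentiableAt_const, ?_⟩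
    have : ∀ t : ℝ, (trivializationAt (EuclideanSpace ℝ (Fin n)) (TangentSpace (𝓡 n)) x
        (⟨x, v + t • u⟩ : TX n X)).2 =
        (trivializationAt (EuclideanSpace ℝ (Fin n)) (TangentSpace (𝓡 n)) x).linearMapAt ℝ x v +
        t • (trivializationAt (EuclideanSpace ℝ (Fin n)) (TangentSpace (𝓡 n)) x).linearMapAt ℝ x
          u := by
      intro t
      rw [← map_smul, ← map_add, Bundle.Trivialization.coe_linearMapAt_of_mem]
      exact FiberBundle.mem_baseSet_trivializationAt' x
    simp only [this]
    rw [mdifferentiableAt_iff_differentiableAt]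
    fun_prop
  have hp : MDifferentiableAt (𝓡 n).tangent (𝓡 n) (Bundle.TotalSpace.proj : TX n X → X)
      ⟨x, v + (0 : ℝ) • u⟩ := Bundle.mdifferentiableAt_proj (TangentSpace (𝓡 n) : X → Type)
  have h := mfderiv_comp (0 : ℝ) (g := (Bundle.TotalSpace.proj : TX n X → X)) hp hd
  have hid : (Bundle.TotalSpace.proj : TX n X → X) ∘ (fun t : ℝ => (⟨x, v + t • u⟩ : TX n X)) =
    fun _ => x := rfl
  rw [hid, mfderiv_const] at h
  have h' : (mfderiv (𝓡 n).tangent (𝓡 n) (Bundle.TotalSpace.proj : TX n X → X)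
      ⟨x, v + (0 : ℝ) • u⟩ : EuclideanSpace ℝ (Fin n) × EuclideanSpace ℝ (Fin n) →L[ℝ]
        EuclideanSpace ℝ (Fin n))
      (mfderiv 𝓘(ℝ, ℝ) (𝓡 n).tangent (fun t : ℝ => (⟨x, v + t • u⟩ : TX n X)) 0 (1 : ℝ)) = 0 :=
    (DFunLike.congr_fun h (1 : ℝ)).symm
  have h0 : v + (0 : ℝ) • u = v := by rw [zero_smul, add_zero]
  generalize mfderiv 𝓘(ℝ, ℝ) (𝓡 n).tangent (fun t : ℝ => (⟨x, v + t • u⟩ : TX n X)) 0 = A at h' ⊢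
  rw [h0] at h'
  exact h'

theorem LinearConnection.bijective (D : LinearConnection n X) (p : TX n X) :
    Function.Bijective fun w : TangentSpace (𝓡 n).tangent p =>
      (mfderiv (𝓡 n).tangent (𝓡 n) (Bundle.TotalSpace.proj : TX n X → X) p w, D.K p w) := by
  let L : TangentSpace (𝓡 n).tangent p →ₗ[ℝ]
      TangentSpace (𝓡 n) p.proj × TangentSpace (𝓡 n) p.proj :=
    (mfderiv (𝓡 n).tangent (𝓡 n) (Bundle.TotalSpace.proj : TX n X → X) p).toLinearMap.prod
      (D.K p).toLinearMap
  have hsurj : Function.Surjective L := by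
    rintro ⟨a, b⟩
    obtain ⟨w, hw⟩ := proj1_surjective_fib p a
    obtain ⟨x, v⟩ := p
    let z : TangentSpace (𝓡 n).tangent (⟨x, v⟩ : TX n X) :=
      mfderiv 𝓘(ℝ, ℝ) (𝓡 n).tangent
        (fun t : ℝ => (⟨x, v + t • (b - D.K ⟨x, v⟩ w)⟩ : TX n X)) 0 (1 : ℝ)
    have h0 : mfderiv (𝓡 n).tangent (𝓡 n) (Bundle.TotalSpace.proj : TX n X → X) ⟨x, v⟩ z = 0 :=
      mfderiv_proj_vertical x v (b - D.K ⟨x, v⟩ w)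
    have h1 : D.K ⟨x, v⟩ z = b - D.K ⟨x, v⟩ w := D.vertical x v (b - D.K ⟨x, v⟩ w)
    refine ⟨w + z, Prod.ext ?_ ?_⟩
    · change mfderiv (𝓡 n).tangent (𝓡 n) (Bundle.TotalSpace.proj : TX n X → X) ⟨x, v⟩ (w + z) = a
      rw [map_add, hw, h0, add_zero]
    · change D.K ⟨x, v⟩ (w + z) = b
      rw [map_add, h1, add_sub_cancel]
  have : FiniteDimensional ℝ (TangentSpace (𝓡 n).tangent p) :=
    inferInstanceAs (FiniteDimensional ℝ (EuclideanSpace ℝ (Fin n) × EuclideanSpace ℝ (Fin n)))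
  have : FiniteDimensional ℝ (TangentSpace (𝓡 n) p.proj) :=
    inferInstanceAs (FiniteDimensional ℝ (EuclideanSpace ℝ (Fin n)))
  refine ⟨(LinearMap.injective_iff_surjective_of_finrank_eq_finrank ?_).2 hsurj, hsurj⟩
  rfl

/-- The vector `a + i b` of the complexification `V ⊗ ℂ` of a real vector space `V`. -/
noncomputable def complexVec {V : Type*} [AddCommGroup V] [Module ℝ V] (a b : V) : ℂ ⊗[ℝ] V :=
  (1 : ℂ) ⊗ₜ[ℝ] a + Complex.I ⊗ₜ[ℝ] b

theorem complexVec_bijective {V : Type*} [AddCommGroup V] [Module ℝ V] :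
    Function.Bijective fun q : V × V => complexVec q.1 q.2 := by
  constructor
  · rintro ⟨a, b⟩ ⟨a', b'⟩ h
    have hre := congrArg (TensorProduct.lift ((LinearMap.lsmul ℝ V) ∘ₗ Complex.reLm)) h
    have him := congrArg (TensorProduct.lift ((LinearMap.lsmul ℝ V) ∘ₗ Complex.imLm)) h
    simp [complexVec] at hre him
    exact Prod.ext hre him
  · intro z
    induction z with
    | zero => exact ⟨(0, 0), by simp [complexVec]⟩
    | tmul c v =>
      refine ⟨(c.re • v, c.im • v), ?_⟩
      simp only [complexVec, ← TensorProduct.smul_tmul, ← TensorProduct.add_tmul]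
      congr 1
      apply Complex.ext <;> simp
    | add x y hx hy =>
      obtain ⟨⟨a, b⟩, rfl⟩ := hx
      obtain ⟨⟨a', b'⟩, rfl⟩ := hy
      refine ⟨(a + a', b + b'), ?_⟩
      simp only [complexVec, TensorProduct.tmul_add]
      abel

variable (n X) in
/-- The complexified tangent bundle `TX ⊗ ℂ` on `X`. -/
noncomputable def complexTangent : CVB X :=
  CVB.ofModels (fun x => ℂ ⊗[ℝ] TangentSpace (𝓡 n) x)
    (fun i => (trivializationAt (EuclideanSpace ℝ (Fin n)) (TangentSpace (𝓡 n)) i).baseSet)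
    (fun _ => ℂ ⊗[ℝ] EuclideanSpace ℝ (Fin n))
    (fun i x => ((trivializationAt (EuclideanSpace ℝ (Fin n))
      (TangentSpace (𝓡 n)) i).linearMapAt ℝ x).baseChange ℂ)
    (fun i x => ((trivializationAt (EuclideanSpace ℝ (Fin n))
      (TangentSpace (𝓡 n)) i).symmₗ ℝ x).baseChange ℂ)
    (fun i => (trivializationAt (EuclideanSpace ℝ (Fin n)) (TangentSpace (𝓡 n)) i).open_baseSet)
    (fun i => FiberBundle.mem_baseSet_trivializationAt' i)
    (fun i x hx v => by
      induction v with
      | zero => simp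
      | tmul c v =>
        rw [LinearMap.baseChange_tmul, LinearMap.baseChange_tmul,
          Bundle.Trivialization.symmₗ_linearMapAt _ hx]
      | add a b ha hb => rw [map_add, map_add, ha, hb])
    (fun i x hx v => by
      induction v with
      | zero => simp
      | tmul c v =>
        rw [LinearMap.baseChange_tmul, LinearMap.baseChange_tmul,
          Bundle.Trivialization.linearMapAt_symmₗ _ hx]
      | add a b ha hb => rw [map_add, map_add, ha, hb])
    (by
      intro i j m φ
      induction m with
      | zero => simpa using continuousOn_const
      | tmul c v =>
        have h := ((continuousOn_coordChange ℝ
          (trivializationAt (EuclideanSpace ℝ (Fin n)) (TangentSpace (𝓡 n)) i)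
          (trivializationAt (EuclideanSpace ℝ (Fin n)) (TangentSpace (𝓡 n)) j)).clm_apply
            (continuousOn_const (c := v)))
        let ψ : EuclideanSpace ℝ (Fin n) →ₗ[ℝ] ℂ :=
          φ.restrictScalars ℝ ∘ₗ TensorProduct.mk ℝ ℂ (EuclideanSpace ℝ (Fin n)) c
        refine ((LinearMap.continuous_of_finiteDimensional ψ).comp_continuousOn h).congr
          fun x hx => ?_
        simp only [LinearMap.baseChange_tmul, Function.comp_apply]
        change φ (c ⊗ₜ _) = φ (c ⊗ₜ _)
        congr 2
        rw [ContinuousLinearEquiv.coe_coe, Bundle.Trivialization.coordChangeL_apply _ _ hx,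
          Bundle.Trivialization.symmₗ_apply _ hx.1,
          Bundle.Trivialization.coe_linearMapAt_of_mem _ hx.2]
      | add a b ha hb =>
        refine (ha.add hb).congr fun y _ => ?_
        simp only [map_add, Pi.add_apply])

variable (n X) in
/-- The bundle `π_X^*(TX ⊗ ℂ)` on `TX`. -/
noncomputable def complexTangentTX : CVB (TX n X) :=
  (complexTangent n X).pullback Bundle.TotalSpace.proj
    (FiberBundle.continuous_proj (EuclideanSpace ℝ (Fin n)) (TangentSpace (𝓡 n) : X → Type))

/-- `T(TX)` as a complex vector bundle over `TX` via `π₀`.  A tangent vector `w ∈ T_p(TX)` with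
vertical part `w_v = K w` and horizontal part `w_h = dπ_X(w)` is identified with the vector
`w_v + i w_h ∈ T_xX ⊗ ℂ`, `x = π_X(p)`; that is, the complex structure `J` on `T_p(TX)` takes the
vertical lift of a vector of `T_xX` to its horizontal lift, and the horizontal lift to minus the
vertical lift. -/
noncomputable def complexBundle0 (D : LinearConnection n X) :
    ComplexBundleOn (proj0 : TTX n X → TX n X) where
  bundle := complexTangentTX n X
  fibEquiv p :=
    { toFun := fun w => w.2 ▸ w.1.2
      invFun := fun v => ⟨⟨p, v⟩, rfl⟩
      left_inv := by rintro ⟨w, rfl⟩; rfl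
      right_inv := fun _ => rfl : {w : TTX n X // proj0 w = p} ≃ TangentSpace (𝓡 n).tangent p }.trans
    ((Equiv.ofBijective _ (D.bijective p)).trans ((Equiv.prodComm _ _).trans
      (Equiv.ofBijective _ complexVec_bijective)))

theorem base_eq_of_proj1_eq {w : TTX n X} {u : TX n X} (h : proj1 w = u) :
    w.proj.proj = u.proj := by
  rw [← h]
  rfl

/-- The vector `w_0 + i w_v` in `T_xX ⊗ ℂ`, for `w ∈ T(TX)` with `π₁ w = u` and `x = π_X(u)`. -/
noncomputable def fib1Vec (D : LinearConnection n X) (u : TX n X)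
    (w : {w : TTX n X // proj1 w = u}) : ℂ ⊗[ℝ] TangentSpace (𝓡 n) u.proj :=
  (base_eq_of_proj1_eq w.2) ▸
    complexVec (w.1.proj.2 : TangentSpace (𝓡 n) w.1.proj.proj) (D.K w.1.proj w.1.2)

theorem fib1Vec_bijective (D : LinearConnection n X) (u : TX n X) :
    Function.Bijective (fib1Vec D u) := by
  obtain ⟨x, b⟩ := u
  constructor
  · rintro ⟨⟨⟨y, a⟩, v⟩, h⟩ ⟨⟨⟨y', a'⟩, v'⟩, h'⟩ e
    obtain rfl : y = x := congrArg Bundle.TotalSpace.proj h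
    obtain rfl : y' = y := congrArg Bundle.TotalSpace.proj h'
    have e' : complexVec a (D.K ⟨y', a⟩ v) = complexVec a' (D.K ⟨y', a'⟩ v') := e
    obtain ⟨rfl, e2⟩ := Prod.ext_iff.1 (complexVec_bijective.1
      (a₁ := (a, D.K ⟨y', a⟩ v)) (a₂ := (a', D.K ⟨y', a'⟩ v')) e')
    have h1 := eq_of_heq (Bundle.TotalSpace.mk.inj (h.trans h'.symm)).2
    obtain rfl : v = v' := (D.bijective ⟨y', a⟩).1 (Prod.ext h1 e2)
    rfl
  · intro z
    obtain ⟨⟨a, k⟩, rfl⟩ := complexVec_bijective.2 z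
    obtain ⟨v, hv⟩ := (D.bijective ⟨x, a⟩).2 (b, k)
    obtain ⟨h1, h2⟩ := Prod.ext_iff.1 hv
    refine ⟨⟨⟨⟨x, a⟩, v⟩, ?_⟩, ?_⟩
    · exact congrArg (Bundle.TotalSpace.mk x) h1
    · exact congrArg (complexVec a) h2

/-- `T(TX)` as a complex vector bundle over `TX` via `π₁ = dπ_X`.  The fibre of `π₁` at `u ∈ T_xX` is
`T_xX ⊕ T_xX = T_xX ⊗ ℂ`: a vector `w` in this fibre which emanates from `w_0 ∈ T_xX` and has the
vertical part `w_v = K w` is identified with `w_0 + i w_v`. -/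
noncomputable def complexBundle1 (D : LinearConnection n X) :
    ComplexBundleOn (proj1 : TTX n X → TX n X) where
  bundle := complexTangentTX n X
  fibEquiv u := Equiv.ofBijective (fib1Vec D u) (fib1Vec_bijective D u)

end Tangent

/-!
The space `T(TX)` is the bundle over `X` of triples `(w_0, w_v, w_h)` of tangent vectors
(`LinearConnection.continuousAt_assemble`). The first bundle structure reads such a triple as a base
point `w_0` together with `w_v + i w_h`, the second one as a base point `w_h` together with
`w_0 + i w_v`. The two readings differ by a cyclic permutation `C` of the three coordinates. This
permutation is even, and the segment `(1 - t) I + t C`, for `t ∈ [0,1]`, joins it to the identity inside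
the invertible matrices, since its determinant is `(1 - t)³ + t³ > 0`. So one obtains a homotopy
between the two pairs (projection to `TX`, tautological section of the pull-back of `TX ⊗ ℂ`).

To use it, the Thom map is constructed for a map `f : Z → B` and a section `s` of a complex vector
bundle on `Z` such that `f` is proper on the zero set of `s` (`ThomData`). It sends `[σ]` to the class
of `f^*σ ⊗ (∧_s + ι_s)`. By the Clifford relation `(∧_s + ι_s)² = |s|²` this bundle map is
invertible where `s ≠ 0` or where `f^*σ` is (`CVB.bijective_koszulMap`). Its continuity is read off in
local trivializations. Hermitian structures exist by partitions of unity (`HermMetric.nonempty`), and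
two of them are joined by convex combinations, so that the class does not depend on them
(`ThomData.mk_triple_eq`). The relations of `K⁰` are preserved, which gives a homomorphism
`ThomData.thomHom`. It is the only Thom map (`ComplexBundleOn.isThomMap_iff`), and homotopic data
have the same one (`ThomData.thomHom_slice`). The homotopy above is proper on its zero set because,
over a compact set of base points, the zeros are the solutions of a linear system that depend
continuously on the base point and on `t` (`LinearConnection.exists_isCompact_of_zeros`).
-/

/-! ### Weak continuity -/

namespace WCont

variable {Y : Type*} [TopologicalSpace Y] {M N : Type*} [AddCommGroup M] [Module ℂ M]
  [AddCommGroup N] [Module ℂ N] {S : Set Y}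

theorem const (m : M) : WCont (fun _ : Y => m) S := fun _ => continuousOn_const

theorem mono {f : Y → M} {T : Set Y} (h : WCont f T) (hST : S ⊆ T) : WCont f S :=
  fun φ => (h φ).mono hST

theorem congr {f g : Y → M} (h : WCont f S) (e : ∀ y ∈ S, g y = f y) : WCont g S :=
  fun φ => (h φ).congr fun y hy => congrArg φ (e y hy)

theorem add {f g : Y → M} (hf : WCont f S) (hg : WCont g S) : WCont (fun y => f y + g y) S :=
  fun φ => ((hf φ).add (hg φ)).congr fun _ _ => map_add φ _ _

theorem prodMk {f : Y → M} {g : Y → N} (hf : WCont f S) (hg : WCont g S) :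
    WCont (fun y => (f y, g y)) S := fun φ =>
  ((hf (φ ∘ₗ LinearMap.inl ℂ M N)).add (hg (φ ∘ₗ LinearMap.inr ℂ M N))).congr fun y _ => by
    simp [← map_add]

/-- A weakly continuous family of linear maps, applied to a weakly continuous family of vectors. -/
theorem apply [FiniteDimensional ℂ M] {T : Y → M →ₗ[ℂ] N} {f : Y → M}
    (hT : ∀ m, WCont (fun y => T y m) S) (hf : WCont f S) : WCont (fun y => T y (f y)) S := by
  intro φ
  have key : ∀ y, φ (T y (f y)) =
      ∑ k, (Module.finBasis ℂ M).coord k (f y) * φ (T y (Module.finBasis ℂ M k)) := by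
    intro y
    conv_lhs => rw [← (Module.finBasis ℂ M).sum_repr (f y)]
    rw [map_sum, map_sum]
    exact Finset.sum_congr rfl fun k _ => by
      rw [map_smul, map_smul, smul_eq_mul, Module.Basis.coord_apply]
  simp only [key]
  exact continuousOn_finsetSum _ fun k _ => (hf _).mul (hT _ φ)

theorem coe_submodule {p : Submodule ℂ M} {f : Y → p} (hf : WCont (fun y => (f y : M)) S) :
    WCont f S := by
  intro φ
  obtain ⟨ψ, rfl⟩ := LinearMap.exists_extend φ
  exact hf ψ

end WCont

/-! ### Continuity of bundle maps -/

namespace CVB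

variable {Y : Type u} [TopologicalSpace Y]

/-- Continuity of a bundle map between bundles given by trivializations in arbitrary models can be
tested in these models. -/
theorem isCont_ofModels {Fib Fib' : Y → Type}
    [∀ y, AddCommGroup (Fib y)] [∀ y, Module ℂ (Fib y)]
    [∀ y, AddCommGroup (Fib' y)] [∀ y, Module ℂ (Fib' y)] {base base' : Y → Set Y}
    {M M' : Y → Type} [∀ i, AddCommGroup (M i)] [∀ i, Module ℂ (M i)]
    [∀ i, FiniteDimensional ℂ (M i)] [∀ i, AddCommGroup (M' i)] [∀ i, Module ℂ (M' i)]
    [∀ i, FiniteDimensional ℂ (M' i)]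
    {toM : ∀ i y, Fib y →ₗ[ℂ] M i} {ofM : ∀ i y, M i →ₗ[ℂ] Fib y}
    {toM' : ∀ i y, Fib' y →ₗ[ℂ] M' i} {ofM' : ∀ i y, M' i →ₗ[ℂ] Fib' y}
    (h1 h2 h3 h4 h5 h1' h2' h3' h4' h5')
    {f : ∀ y, Fib y →ₗ[ℂ] Fib' y}
    (H : ∀ i j m, WCont (fun y => toM' j y (f y (ofM i y m))) (base i ∩ base' j)) :
    IsCont (ofModels Fib base M toM ofM h1 h2 h3 h4 h5)
      (ofModels Fib' base' M' toM' ofM' h1' h2' h3' h4' h5') f := fun i j m =>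
  continuousOn_pi.2 fun k => H i j ((Module.finBasis ℂ (M i)).equivFun.symm m)
    ((Module.finBasis ℂ (M' j)).coord k)

theorem IsCont.wcont {E F : CVB Y} {f : ∀ y, E.Fib y →ₗ[ℂ] F.Fib y} (h : IsCont E F f) (i j m) :
    WCont (fun y => F.toModel j y (f y (E.ofModel i y m))) (E.base i ∩ F.base j) :=
  WCont.of_continuousOn (h i j m)

theorem isCont_id (E : CVB Y) : IsCont E E (fun _ => LinearMap.id) := E.continuousOn_transition

theorem IsCont.neg {E F : CVB Y} {f : ∀ y, E.Fib y →ₗ[ℂ] F.Fib y} (h : IsCont E F f) :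
    IsCont E F (fun y => -f y) := fun i j m =>
  (h i j m).neg.congr fun y _ => by simp

theorem IsCont.pullback {Z : Type u} [TopologicalSpace Z] {g : Z → Y} (hg : Continuous g)
    {E F : CVB Y} {f : ∀ y, E.Fib y →ₗ[ℂ] F.Fib y} (h : IsCont E F f) :
    IsCont (E.pullback g hg) (F.pullback g hg) (fun z => f (g z)) := fun i j m =>
  (h (g i) (g j) m).comp hg.continuousOn fun _ hz => hz

theorem IsCont.tensor {E F A B : CVB Y} {f : ∀ y, E.Fib y →ₗ[ℂ] F.Fib y}
    {g : ∀ y, A.Fib y →ₗ[ℂ] B.Fib y} (hf : IsCont E F f) (hg : IsCont A B g) :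
    IsCont (E.tensor A) (F.tensor B) (fun y => TensorProduct.map (f y) (g y)) := by
  refine isCont_ofModels _ _ _ _ _ _ _ _ _ _ fun i j m => ?_
  induction m with
  | zero => simpa using WCont.const _
  | tmul a b =>
    exact ((hf.wcont i j a).mono fun y hy => ⟨hy.1.1, hy.2.1⟩).bilin
      ((hg.wcont i j b).mono fun y hy => ⟨hy.1.2, hy.2.2⟩) (TensorProduct.mk ℂ _ _)
  | add a b ha hb => simpa only [map_add] using ha.add hb

theorem IsCont.prodCoprod {E F A B : CVB Y} {a : ∀ y, E.Fib y →ₗ[ℂ] A.Fib y}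
    {b : ∀ y, F.Fib y →ₗ[ℂ] A.Fib y} {c : ∀ y, E.Fib y →ₗ[ℂ] B.Fib y}
    {d : ∀ y, F.Fib y →ₗ[ℂ] B.Fib y} (ha : IsCont E A a) (hb : IsCont F A b)
    (hc : IsCont E B c) (hd : IsCont F B d) :
    IsCont (E.sum F) (A.sum B)
      (fun y => ((a y).coprod (b y)).prod ((c y).coprod (d y))) := by
  refine isCont_ofModels _ _ _ _ _ _ _ _ _ _ fun i j m => ?_
  have h1 : WCont _ (E.base i ∩ F.base i ∩ (A.base j ∩ B.base j)) :=
    (((ha.wcont i j m.1).mono fun y hy => ⟨hy.1.1, hy.2.1⟩).add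
    ((hb.wcont i j m.2).mono fun y hy => ⟨hy.1.2, hy.2.1⟩)).prodMk
    (((hc.wcont i j m.1).mono fun y hy => ⟨hy.1.1, hy.2.2⟩).add
    ((hd.wcont i j m.2).mono fun y hy => ⟨hy.1.2, hy.2.2⟩))
  refine h1.congr fun y _ => ?_
  simp only [← map_add]
  rfl

theorem IsCont.prodMap {E F A B : CVB Y} {a : ∀ y, E.Fib y →ₗ[ℂ] A.Fib y}
    {d : ∀ y, F.Fib y →ₗ[ℂ] B.Fib y} (ha : IsCont E A a) (hd : IsCont F B d) :
    IsCont (E.sum F) (A.sum B) (fun y => (a y).prodMap (d y)) := by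
  refine isCont_ofModels _ _ _ _ _ _ _ _ _ _ fun i j m => ?_
  exact ((ha.wcont i j m.1).mono fun y hy => ⟨hy.1.1, hy.2.1⟩).prodMk
    ((hd.wcont i j m.2).mono fun y hy => ⟨hy.1.2, hy.2.2⟩)

theorem isCont_fst (E F : CVB Y) : IsCont (E.sum F) E (fun _ => LinearMap.fst ℂ _ _) :=
  fun i j _ => (E.continuousOn_transition i j _).mono fun _ hy => ⟨hy.1.1, hy.2⟩

theorem isCont_snd (E F : CVB Y) : IsCont (E.sum F) F (fun _ => LinearMap.snd ℂ _ _) :=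
  fun i j _ => (F.continuousOn_transition i j _).mono fun _ hy => ⟨hy.1.2, hy.2⟩

theorem IsCont.prod {E A B : CVB Y} {a : ∀ y, E.Fib y →ₗ[ℂ] A.Fib y}
    {b : ∀ y, E.Fib y →ₗ[ℂ] B.Fib y} (ha : IsCont E A a) (hb : IsCont E B b) :
    IsCont E (A.sum B) (fun y => (a y).prod (b y)) := fun i j m =>
  continuousOn_pi.2 fun k =>
    (((ha.wcont i j m).mono fun _ hy => ⟨hy.1, hy.2.1⟩).prodMk
      ((hb.wcont i j m).mono fun _ hy => ⟨hy.1, hy.2.2⟩))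
      ((Module.finBasis ℂ ((Fin (A.rk j) → ℂ) × (Fin (B.rk j) → ℂ))).coord k)

/-- Continuity of a section of a complex vector bundle, tested in the local trivializations. -/
def IsContSection (E : CVB Y) (s : ∀ y, E.Fib y) : Prop :=
  ∀ i, ContinuousOn (fun y => E.toModel i y (s y)) (E.base i)

theorem IsContSection.pullback {Z : Type u} [TopologicalSpace Z] {g : Z → Y} (hg : Continuous g)
    {E : CVB Y} {s : ∀ y, E.Fib y} (h : E.IsContSection s) :
    (E.pullback g hg).IsContSection (fun z => s (g z)) := fun i =>
  (h (g i)).comp hg.continuousOn fun _ hz => hz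

end CVB

/-! ### Hermitian structures: operations, and continuity of adjoints -/

namespace HermMetric

open CVB

variable {Y : Type u} [TopologicalSpace Y]

@[ext]
theorem ext {E : CVB Y} {h h' : HermMetric E} (e : h.form = h'.form) : h = h' := by
  cases h; cases h'; cases e; rfl

/-- The pull-back of a hermitian structure. -/
def pullback {Z : Type u} [TopologicalSpace Z] (f : Z → Y) (hf : Continuous f) {E : CVB Y}
    (h : HermMetric E) : HermMetric (E.pullback f hf) where
  form z := h.form (f z)
  conj_symm z := h.conj_symm (f z)
  pos z := h.pos (f z)
  cont i m m' := (h.cont (f i) m m').comp hf.continuousOn fun _ hz => hz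

theorem eq_zero_of_forall {E : CVB Y} (h : HermMetric E) (y : Y) {v : E.Fib y}
    (hv : ∀ w, h.form y v w = 0) : v = 0 := by
  by_contra h0
  have := h.pos y v h0
  simp [hv] at this

theorem eq_of_forall {E : CVB Y} (h : HermMetric E) (y : Y) {v v' : E.Fib y}
    (hv : ∀ w, h.form y v w = h.form y v' w) : v = v' :=
  sub_eq_zero.1 (h.eq_zero_of_forall y fun w => by
    rw [map_sub, LinearMap.sub_apply, hv, sub_self])

theorem form_self_re_nonneg {E : CVB Y} (h : HermMetric E) (y : Y) (v : E.Fib y) :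
    0 ≤ (h.form y v v).re := by
  by_cases hv : v = 0
  · simp [hv]
  · exact (h.pos y v hv).le

theorem form_sum_single {E : CVB Y} (h : HermMetric E) (j y : Y) (u : Fin (E.rk j) → ℂ)
    (w : E.Fib y) : h.form y (E.ofModel j y u) w =
      ∑ l, starRingEnd ℂ (u l) * h.form y (E.ofModel j y (Pi.single l 1)) w := by
  have hu : u = ∑ l, u l • (Pi.single l 1 : Fin (E.rk j) → ℂ) := by
    conv_lhs => rw [pi_eq_sum_univ' u]
  conv_lhs => rw [hu]
  rw [map_sum, map_sum, LinearMap.sum_apply]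
  refine Finset.sum_congr rfl fun l _ => ?_
  rw [map_smul, LinearMap.map_smulₛₗ, LinearMap.smul_apply, smul_eq_mul]

theorem continuousOn_form_sections {E : CVB Y} (h : HermMetric E) {S : Set Y} {k : Y}
    (hS : S ⊆ E.base k) {s t : ∀ y, E.Fib y}
    (hs : ContinuousOn (fun y => E.toModel k y (s y)) S)
    (ht : ContinuousOn (fun y => E.toModel k y (t y)) S) :
    ContinuousOn (fun y => h.form y (s y) (t y)) S := by
  have h1 : ContinuousOn (fun y => ∑ l, starRingEnd ℂ (E.toModel k y (s y) l) *
      starRingEnd ℂ (∑ r, starRingEnd ℂ (E.toModel k y (t y) r) *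
        h.form y (E.ofModel k y (Pi.single r 1)) (E.ofModel k y (Pi.single l 1)))) S :=
    continuousOn_finsetSum _ fun l _ =>
      (Complex.continuous_conj.comp_continuousOn (continuousOn_pi.1 hs l)).mul
        (Complex.continuous_conj.comp_continuousOn (continuousOn_finsetSum _ fun r _ =>
          (Complex.continuous_conj.comp_continuousOn (continuousOn_pi.1 ht r)).mul
            ((h.cont k _ _).mono hS)))
  refine h1.congr fun y hy => ?_
  simp only []
  conv_lhs => rw [← E.ofModel_toModel k y (hS hy) (s y), form_sum_single]
  refine Finset.sum_congr rfl fun l _ => ?_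
  rw [← form_sum_single, E.ofModel_toModel k y (hS hy), h.conj_symm]

/-- The Gram matrix of a hermitian structure in a local trivialization. -/
noncomputable def gram {E : CVB Y} (h : HermMetric E) (j y : Y) :
    Matrix (Fin (E.rk j)) (Fin (E.rk j)) ℂ :=
  Matrix.of fun l k => h.form y (E.ofModel j y (Pi.single l 1)) (E.ofModel j y (Pi.single k 1))

theorem gram_det_ne_zero {E : CVB Y} (h : HermMetric E) {j y : Y} (hy : y ∈ E.base j) :
    (h.gram j y).det ≠ 0 := by
  intro h0
  obtain ⟨u, hu0, hu⟩ := Matrix.exists_vecMul_eq_zero_iff.2 h0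
  let u' : Fin (E.rk j) → ℂ := fun l => starRingEnd ℂ (u l)
  have h1 : ∀ k, h.form y (E.ofModel j y u') (E.ofModel j y (Pi.single k 1)) = 0 := by
    intro k
    rw [form_sum_single]
    simpa [u', Matrix.vecMul, dotProduct, gram] using congrFun hu k
  have h2 : E.ofModel j y u' = 0 := by
    refine h.eq_zero_of_forall y fun w => ?_
    have : h.form y (E.ofModel j y u') ∘ₗ E.ofModel j y = 0 := by
      refine LinearMap.pi_ext' fun k => LinearMap.ext_ring ?_
      simpa using h1 k
    rw [← E.ofModel_toModel j y hy w]
    exact DFunLike.congr_fun this _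
  have h3 : u' = 0 := by
    rw [← E.toModel_ofModel j y hy u', h2, map_zero]
  exact hu0 (funext fun l => by simpa [u'] using congrFun h3 l)

theorem continuousOn_gram_inv {E : CVB Y} (h : HermMetric E) (j : Y) :
    ContinuousOn (fun y => (h.gram j y)⁻¹) (E.base j) := by
  have hG : ContinuousOn (fun y => h.gram j y) (E.base j) :=
    continuousOn_pi.2 fun l => continuousOn_pi.2 fun k => h.cont j _ _
  rw [continuousOn_iff_continuous_domRestrict] at hG ⊢
  have := (hG.matrix_det.inv₀ fun y => h.gram_det_ne_zero y.2).smul hG.matrix_adjugate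
  refine this.congr fun y => ?_
  simp only [Set.domRestrict_apply, Matrix.inv_def, Ring.inverse_eq_inv']
  rfl

/-- The adjoint is continuous, because in local trivializations it is obtained from the continuous
matrix of the forms `⟨w, σ v⟩` by the inverse of a Gram matrix. -/
theorem isCont_bundleAdjoint {E F : CVB Y} (hE : HermMetric E) (hF : HermMetric F)
    {σ : ∀ y, E.Fib y →ₗ[ℂ] F.Fib y} (hσ : IsCont E F σ) :
    IsCont F E (bundleAdjoint hE hF σ) := by
  intro i j m
  -- By the defining property of the adjoint, the conjugate of its value `u` satisfies
  -- `ū * gram = r`.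
  let r : Y → Fin (E.rk j) → ℂ := fun y k =>
    hF.form y (F.ofModel i y m) (σ y (E.ofModel j y (Pi.single k 1)))
  have hr : ContinuousOn r (F.base i ∩ E.base j) := by
    refine continuousOn_pi.2 fun k => ?_
    exact hF.continuousOn_form_sections Set.inter_subset_left
      ((F.continuousOn_transition i i m).mono fun y hy => ⟨hy.1, hy.1⟩)
      ((hσ j i (Pi.single k 1)).mono fun y hy => ⟨hy.2, hy.1⟩)
  have hc : ContinuousOn (fun y => Matrix.vecMul (r y) (hE.gram j y)⁻¹)
      (F.base i ∩ E.base j) := by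
    have hG := (hE.continuousOn_gram_inv j).mono (Set.inter_subset_right (s := F.base i))
    rw [continuousOn_iff_continuous_domRestrict] at hr hG ⊢
    exact hr.matrix_vecMul hG
  have hstar : ContinuousOn (fun y => star (Matrix.vecMul (r y) (hE.gram j y)⁻¹))
      (F.base i ∩ E.base j) := hc.star
  refine hstar.congr fun y hy => ?_
  set u := E.toModel j y (bundleAdjoint hE hF σ y (F.ofModel i y m)) with hu
  have hur : Matrix.vecMul (star u) (hE.gram j y) = r y := by
    funext k
    have := form_sum_single hE j y u (E.ofModel j y (Pi.single k 1))
    rw [hu, E.ofModel_toModel j y hy.2, bundleAdjoint_spec] at this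
    exact this.symm
  simp only []
  rw [← hur, Matrix.vecMul_vecMul, Matrix.mul_nonsing_inv _
    (Ne.isUnit (hE.gram_det_ne_zero hy.2)), Matrix.vecMul_one, star_star]

end HermMetric

/-! ### The Koszul map -/

section Algebra

variable {V W : Type*} [AddCommGroup V] [Module ℂ V] [AddCommGroup W] [Module ℂ W]

/-- Contractions are natural with respect to linear maps. -/
theorem ExteriorAlgebra.map_contractLeft (f : V →ₗ[ℂ] W) (d : Module.Dual ℂ W)
    (x : ExteriorAlgebra ℂ V) :
    CliffordAlgebra.contractLeft (Q := (0 : QuadraticForm ℂ W)) d (ExteriorAlgebra.map f x) =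
      ExteriorAlgebra.map f
        (CliffordAlgebra.contractLeft (Q := (0 : QuadraticForm ℂ V)) (d ∘ₗ f) x) := by
  induction x using CliffordAlgebra.left_induction with
  | algebraMap r =>
    have : ExteriorAlgebra.map f (algebraMap ℂ (ExteriorAlgebra ℂ V) r) =
      algebraMap ℂ (ExteriorAlgebra ℂ W) r := AlgHom.commutes _ _
    rw [CliffordAlgebra.contractLeft_algebraMap, map_zero]
    exact (congrArg _ this).trans (CliffordAlgebra.contractLeft_algebraMap _ d r)
  | add x y hx hy => simp only [map_add, hx, hy]
  | ι_mul x v hx =>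
    have h2 : ExteriorAlgebra.map f (ExteriorAlgebra.ι ℂ v * x) =
      ExteriorAlgebra.ι ℂ (f v) * ExteriorAlgebra.map f x := by
      rw [map_mul, ExteriorAlgebra.map_apply_ι]
    have h3 : CliffordAlgebra.contractLeft (Q := (0 : QuadraticForm ℂ V)) (d ∘ₗ f)
        (ExteriorAlgebra.ι ℂ v * x) = d (f v) • x - ExteriorAlgebra.ι ℂ v *
          CliffordAlgebra.contractLeft (Q := (0 : QuadraticForm ℂ V)) (d ∘ₗ f) x :=
      CliffordAlgebra.contractLeft_ι_mul ..
    have h4 : CliffordAlgebra.contractLeft (Q := (0 : QuadraticForm ℂ W)) d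
        (ExteriorAlgebra.ι ℂ (f v) * ExteriorAlgebra.map f x) =
        d (f v) • ExteriorAlgebra.map f x - ExteriorAlgebra.ι ℂ (f v) *
          CliffordAlgebra.contractLeft (Q := (0 : QuadraticForm ℂ W)) d
            (ExteriorAlgebra.map f x) :=
      CliffordAlgebra.contractLeft_ι_mul ..
    refine (congrArg _ h2).trans (h4.trans ?_)
    refine Eq.trans ?_ (congrArg (ExteriorAlgebra.map f) h3).symm
    rw [hx, map_sub, map_smul, map_mul, ExteriorAlgebra.map_apply_ι]

theorem thomFib_coe (h : V →ₗ⋆[ℂ] V →ₗ[ℂ] ℂ) (v : V) (i j : ZMod 2) (hij : j = i + 1)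
    (x : ExtPart V i) : (thomFib h v i j hij x : ExteriorAlgebra ℂ V) =
      ExteriorAlgebra.ι ℂ v * (x : ExteriorAlgebra ℂ V) +
        CliffordAlgebra.contractLeft (Q := (0 : QuadraticForm ℂ V)) (h v) (x : ExteriorAlgebra ℂ V) :=
  rfl

/-- The square of `∧_v + ι_v` is multiplication by `⟨v, v⟩`. -/
theorem thomFib_thomFib (h : V →ₗ⋆[ℂ] V →ₗ[ℂ] ℂ) (v : V) (i j : ZMod 2) (hij : j = i + 1)
    (hji : i = j + 1) :
    thomFib h v j i hji ∘ₗ thomFib h v i j hij = h v v • LinearMap.id := by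
  refine LinearMap.ext fun x => Subtype.ext ?_
  rw [LinearMap.comp_apply, thomFib_coe, thomFib_coe, map_add, mul_add, ← mul_assoc]
  have h1 : ExteriorAlgebra.ι ℂ v * ExteriorAlgebra.ι ℂ v = 0 := ExteriorAlgebra.ι_sq_zero v
  have h2 : CliffordAlgebra.contractLeft (Q := (0 : QuadraticForm ℂ V)) (h v)
      (ExteriorAlgebra.ι ℂ v * (x : ExteriorAlgebra ℂ V)) =
      h v v • (x : ExteriorAlgebra ℂ V) - ExteriorAlgebra.ι ℂ v *
        CliffordAlgebra.contractLeft (Q := (0 : QuadraticForm ℂ V)) (h v) (x : ExteriorAlgebra ℂ V) :=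
    CliffordAlgebra.contractLeft_ι_mul ..
  rw [h1, h2, CliffordAlgebra.contractLeft_contractLeft]
  simp

variable {E F A B : Type*} [AddCommGroup E] [Module ℂ E] [AddCommGroup F] [Module ℂ F]
  [AddCommGroup A] [Module ℂ A] [AddCommGroup B] [Module ℂ B]

@[simp]
theorem sharp_apply (σ : E →ₗ[ℂ] F) (σ' : F →ₗ[ℂ] E) (τ : A →ₗ[ℂ] B) (τ' : B →ₗ[ℂ] A)
    (p : (E ⊗[ℂ] A) × (F ⊗[ℂ] B)) : sharp σ σ' τ τ' p =
      (TensorProduct.map σ LinearMap.id p.1 - TensorProduct.map LinearMap.id τ' p.2,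
        TensorProduct.map LinearMap.id τ p.1 + TensorProduct.map σ' LinearMap.id p.2) := by
  simp [sharp, sub_eq_add_neg]

/-- If `τ' τ` and `τ τ'` are multiplication by `c`, then the square of the matrix
`(σ ⊗ 1, - 1 ⊗ τ'; 1 ⊗ τ, σ' ⊗ 1)` and its formal adjoint is diagonal. -/
theorem sharp_sharp (σ : E →ₗ[ℂ] F) (σ' : F →ₗ[ℂ] E) (τ : A →ₗ[ℂ] B) (τ' : B →ₗ[ℂ] A) (c : ℂ)
    (h : τ' ∘ₗ τ = c • LinearMap.id) (h' : τ ∘ₗ τ' = c • LinearMap.id) :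
    sharp σ' σ (-τ) (-τ') ∘ₗ sharp σ σ' τ τ' =
      (TensorProduct.map (σ' ∘ₗ σ + c • LinearMap.id) LinearMap.id).prodMap
        (TensorProduct.map (σ ∘ₗ σ' + c • LinearMap.id) LinearMap.id) := by
  have h1 : ∀ a, τ' (τ a) = c • a := fun a => DFunLike.congr_fun h a
  have h2 : ∀ b, τ (τ' b) = c • b := fun b => DFunLike.congr_fun h' b
  refine LinearMap.prod_ext ?_ ?_
  · refine TensorProduct.ext' fun e a => ?_
    simp [h1, TensorProduct.add_tmul, TensorProduct.smul_tmul, TensorProduct.tmul_neg]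
  · refine TensorProduct.ext' fun f b => ?_
    simp [h2, TensorProduct.add_tmul, TensorProduct.smul_tmul, TensorProduct.tmul_neg, add_comm]

theorem bijective_tensorMap_id [FiniteDimensional ℂ E] {f : E →ₗ[ℂ] E}
    (hf : Function.Injective f) :
    Function.Bijective (TensorProduct.map f (LinearMap.id : A →ₗ[ℂ] A)) :=
  (TensorProduct.congr (LinearEquiv.ofBijective f
    ⟨hf, (LinearMap.injective_iff_surjective (f := f)).1 hf⟩) (LinearEquiv.refl ℂ A)).bijective

theorem bijective_sharp [FiniteDimensional ℂ E] [FiniteDimensional ℂ F] (σ : E →ₗ[ℂ] F)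
    (σ' : F →ₗ[ℂ] E) (τ : A →ₗ[ℂ] B) (τ' : B →ₗ[ℂ] A) (c : ℂ)
    (h : τ' ∘ₗ τ = c • LinearMap.id) (h' : τ ∘ₗ τ' = c • LinearMap.id)
    (h1 : Function.Injective (σ' ∘ₗ σ + c • LinearMap.id : E →ₗ[ℂ] E))
    (h2 : Function.Injective (σ ∘ₗ σ' + c • LinearMap.id : F →ₗ[ℂ] F)) :
    Function.Bijective (sharp σ σ' τ τ') := by
  have e1 := sharp_sharp σ σ' τ τ' c h h'
  have e2 := sharp_sharp σ' σ (-τ) (-τ') c (by simpa using h) (by simpa using h')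
  rw [neg_neg, neg_neg] at e2
  have b1 : Function.Bijective (sharp σ' σ (-τ) (-τ') ∘ₗ sharp σ σ' τ τ') := by
    rw [e1]
    exact (bijective_tensorMap_id h1).prodMap (bijective_tensorMap_id h2)
  have b2 : Function.Bijective (sharp σ σ' τ τ' ∘ₗ sharp σ' σ (-τ) (-τ')) := by
    rw [e2]
    exact (bijective_tensorMap_id h2).prodMap (bijective_tensorMap_id h1)
  rw [LinearMap.coe_comp] at b1 b2
  exact ⟨Function.Injective.of_comp b1.1, Function.Surjective.of_comp b2.2⟩

end Algebra

/-- The map `A^* A + c` is injective if `A` is, or if `c` has positive real part. -/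
theorem HermMetric.injective_adjoint_comp_add {Y : Type u} [TopologicalSpace Y] {E F : CVB Y} (hE : HermMetric E)
    (hF : HermMetric F) {y : Y} {A : E.Fib y →ₗ[ℂ] F.Fib y} {B : F.Fib y →ₗ[ℂ] E.Fib y}
    (hAB : ∀ w v, hE.form y (B w) v = hF.form y w (A v)) {c : ℂ} (hc : 0 ≤ c.re)
    (hinj : Function.Injective A ∨ 0 < c.re) :
    Function.Injective (B ∘ₗ A + c • LinearMap.id : E.Fib y →ₗ[ℂ] E.Fib y) := by
  refine (injective_iff_map_eq_zero _).2 fun v hv => ?_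
  have h1 : hE.form y v (B (A v) + c • v) = 0 := by
    have : B (A v) + c • v = 0 := hv
    rw [this, map_zero]
  have h2 : hE.form y v (B (A v)) = starRingEnd ℂ (hF.form y (A v) (A v)) := by
    rw [← hE.conj_symm, hAB]
  have him : (hE.form y v v).im = 0 := by
    have := congrArg Complex.im (hE.conj_symm y v v)
    rw [Complex.conj_im] at this
    linarith
  have h3 : (hF.form y (A v) (A v)).re + c.re * (hE.form y v v).re = 0 := by
    rw [map_add, h2, map_smul, smul_eq_mul] at h1
    have := congrArg Complex.re h1
    simpa [him] using this
  have h4 := hF.form_self_re_nonneg y (A v)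
  have h5 := hE.form_self_re_nonneg y v
  by_contra h0
  have h6 := hE.pos y v h0
  rcases hinj with hA | hc'
  · have := hF.pos y (A v) fun h => h0 (hA (h.trans (map_zero A).symm))
    nlinarith
  · nlinarith

namespace CVB

variable {Y : Type u} [TopologicalSpace Y]

theorem isCont_thomFib {V : CVB Y} (h : HermMetric V) {s : ∀ y, V.Fib y} (hs : V.IsContSection s)
    (i j : ZMod 2) (hij : j = i + 1) :
    IsCont (V.ext i) (V.ext j) (fun y => thomFib (h.form y) (s y) i j hij) := by
  refine isCont_ofModels _ _ _ _ _ _ _ _ _ _ fun k l m => ?_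
  refine WCont.coe_submodule ?_
  -- The map `∧_s + ι_s`, read in the trivialization with index `k`, is `∧_u + ι_d`.
  let u : Y → Fin (V.rk k) → ℂ := fun y => V.toModel k y (s y)
  let d : Y → Module.Dual ℂ (Fin (V.rk k) → ℂ) := fun y => h.form y (s y) ∘ₗ V.ofModel k y
  have hu : WCont u (V.base k) := WCont.of_continuousOn (hs k)
  have hd : WCont d (V.base k) := by
    intro φ
    have : ContinuousOn (fun y => ∑ r, d y (Pi.single r 1) * φ (LinearMap.proj r)) (V.base k) :=
      continuousOn_finsetSum _ fun r _ =>
        (h.continuousOn_form_sections subset_rfl (hs k) ((V.continuousOn_transition k k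
          (Pi.single r 1)).mono fun _ hy => ⟨hy, hy⟩)).mul continuousOn_const
    refine this.congr fun y _ => ?_
    have e : d y = ∑ r, d y (Pi.single r 1) • LinearMap.proj r := by
      refine LinearMap.pi_ext' fun r => LinearMap.ext_ring ?_
      simp [Pi.single_apply]
    conv_lhs => rw [e]
    simp only [map_sum, map_smul, smul_eq_mul]
  have hx : WCont (fun y => ExteriorAlgebra.ι ℂ (u y) * m.1 +
      CliffordAlgebra.contractLeft (Q := (0 : QuadraticForm ℂ (Fin (V.rk k) → ℂ))) (d y) m.1)
      (V.base k) :=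
    (hu.map ((LinearMap.mul ℂ (ExteriorAlgebra ℂ (Fin (V.rk k) → ℂ))).flip m.1 ∘ₗ
      ExteriorAlgebra.ι ℂ)).add
      (hd.map ((CliffordAlgebra.contractLeft
        (Q := (0 : QuadraticForm ℂ (Fin (V.rk k) → ℂ)))).flip m.1))
  have key := WCont.apply (Y := Y) (S := V.base k ∩ V.base l)
    (T := fun y => (ExteriorAlgebra.map (V.toModel l y ∘ₗ V.ofModel k y)).toLinearMap)
    (fun x => WCont.extMap (V.wcont_transition k l) x) (hx.mono Set.inter_subset_left)
  refine key.congr fun y hy => ?_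
  change ExteriorAlgebra.map (V.toModel l y) (ExteriorAlgebra.ι ℂ (s y) *
    ExteriorAlgebra.map (V.ofModel k y) m.1 +
      CliffordAlgebra.contractLeft (Q := (0 : QuadraticForm ℂ (V.Fib y))) (h.form y (s y))
        (ExteriorAlgebra.map (V.ofModel k y) m.1)) =
    ExteriorAlgebra.map (V.toModel l y ∘ₗ V.ofModel k y) _
  rw [← ExteriorAlgebra.map_comp_map, AlgHom.comp_apply, ExteriorAlgebra.map_contractLeft,
    map_add (ExteriorAlgebra.map (V.ofModel k y)), map_mul (ExteriorAlgebra.map (V.ofModel k y)),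
    ExteriorAlgebra.map_apply_ι, V.ofModel_toModel k y hy.1]

/-- The bundle `E ⊗ Λ^{ev} V ⊕ F ⊗ Λ^{odd} V`. -/
noncomputable def koszulDom (E F V : CVB Y) : CVB Y :=
  (E.tensor (V.ext 0)).sum (F.tensor (V.ext 1))

/-- The bundle map `σ ⊗ τ` from `E ⊗ Λ^{ev} V ⊕ F ⊗ Λ^{odd} V` to `F ⊗ Λ^{ev} V ⊕ E ⊗ Λ^{odd} V`,
where `σ : E → F` is a bundle map and `τ = ∧_s + ι_s` for a section `s` of `V`. -/
noncomputable def koszulMap {E F V : CVB Y} (σ : ∀ y, E.Fib y →ₗ[ℂ] F.Fib y) (hE : HermMetric E)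
    (hF : HermMetric F) (h : HermMetric V) (s : ∀ y, V.Fib y) (y : Y) :
    (koszulDom E F V).Fib y →ₗ[ℂ] (koszulDom F E V).Fib y :=
  sharp (σ y) (bundleAdjoint hE hF σ y) (thomFib (h.form y) (s y) 0 1 (by decide))
    (thomFib (h.form y) (s y) 1 0 (by decide))

theorem isCont_koszulMap {E F V : CVB Y} {σ : ∀ y, E.Fib y →ₗ[ℂ] F.Fib y} (hσ : IsCont E F σ)
    (hE : HermMetric E) (hF : HermMetric F) (h : HermMetric V) {s : ∀ y, V.Fib y}
    (hs : V.IsContSection s) :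
    IsCont (koszulDom E F V) (koszulDom F E V) (koszulMap σ hE hF h s) :=
  (hσ.tensor (isCont_id _)).prodCoprod
    ((isCont_id _).tensor (isCont_thomFib h hs 1 0 (by decide))).neg
    ((isCont_id _).tensor (isCont_thomFib h hs 0 1 (by decide)))
    ((HermMetric.isCont_bundleAdjoint hE hF hσ).tensor (isCont_id _))

/-- The bundle map `σ ⊗ τ` is an isomorphism wherever `σ` is one or `s` does not vanish: the
compositions with its adjoint are `(σ^*σ + |s|²) ⊗ 1` and `(σσ^* + |s|²) ⊗ 1` on the summands. -/
theorem bijective_koszulMap {E F V : CVB Y} {σ : ∀ y, E.Fib y →ₗ[ℂ] F.Fib y}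
    (hE : HermMetric E) (hF : HermMetric F) (h : HermMetric V) {s : ∀ y, V.Fib y} {y : Y}
    (hy : Function.Bijective (σ y) ∨ s y ≠ 0) :
    Function.Bijective (koszulMap σ hE hF h s y) := by
  have hspec := bundleAdjoint_spec hE hF σ y
  have hc := h.form_self_re_nonneg y (s y)
  refine bijective_sharp _ _ _ _ (h.form y (s y) (s y)) (thomFib_thomFib _ _ _ _ _ _)
    (thomFib_thomFib _ _ _ _ _ _) ?_ ?_
  · exact hE.injective_adjoint_comp_add hF hspec hc (hy.imp (fun h => h.1) (h.pos y _))
  · refine hF.injective_adjoint_comp_add hE (fun v w => ?_) hc (hy.imp (fun hb => ?_) (h.pos y _))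
    · rw [← hF.conj_symm, ← hspec, hE.conj_symm]
    · refine (injective_iff_map_eq_zero _).2 fun w hw => hF.eq_zero_of_forall y fun w' => ?_
      obtain ⟨v, rfl⟩ := hb.2 w'
      rw [← hspec, hw, map_zero, LinearMap.zero_apply]

end CVB

/-! ### Existence and deformation of hermitian structures -/

section Forms

variable {V W : Type*} [AddCommGroup V] [Module ℂ V] [AddCommGroup W] [Module ℂ W]

/-- The orthogonal sum of sesquilinear forms. -/
def sesqSum (h : V →ₗ⋆[ℂ] V →ₗ[ℂ] ℂ) (k : W →ₗ⋆[ℂ] W →ₗ[ℂ] ℂ) : V × W →ₗ⋆[ℂ] V × W →ₗ[ℂ] ℂ :=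
  LinearMap.mk₂'ₛₗ (starRingEnd ℂ) (RingHom.id ℂ) (fun v w => h v.1 w.1 + k v.2 w.2)
    (fun v v' w => by simp only [Prod.fst_add, Prod.snd_add, map_add, LinearMap.add_apply]; ring)
    (fun c v w => by
      simp only [Prod.smul_fst, Prod.smul_snd, LinearMap.map_smulₛₗ, LinearMap.smul_apply, smul_add])
    (fun v w w' => by simp only [Prod.fst_add, Prod.snd_add, map_add]; ring)
    (fun c v w => by
      simp only [Prod.smul_fst, Prod.smul_snd, map_smul, RingHom.id_apply, smul_add])

/-- The pull-back of a sesquilinear form by a linear map. -/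
def sesqComap (h : W →ₗ⋆[ℂ] W →ₗ[ℂ] ℂ) (a : V →ₗ[ℂ] W) : V →ₗ⋆[ℂ] V →ₗ[ℂ] ℂ :=
  LinearMap.mk₂'ₛₗ (starRingEnd ℂ) (RingHom.id ℂ) (fun v w => h (a v) (a w))
    (fun v v' w => by simp only [map_add, LinearMap.add_apply])
    (fun c v w => by simp only [map_smul, LinearMap.map_smulₛₗ, LinearMap.smul_apply])
    (fun v w w' => by simp only [map_add])
    (fun c v w => by simp only [map_smul, RingHom.id_apply])

/-- The convex combination `(1 - t) h + t k` of sesquilinear forms. -/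
def sesqMix (t : ℝ) (h k : V →ₗ⋆[ℂ] V →ₗ[ℂ] ℂ) : V →ₗ⋆[ℂ] V →ₗ[ℂ] ℂ :=
  ((1 - t : ℝ) : ℂ) • h + (t : ℂ) • k

theorem sesqMix_apply (t : ℝ) (h k : V →ₗ⋆[ℂ] V →ₗ[ℂ] ℂ) (v w : V) :
    sesqMix t h k v w = ((1 - t : ℝ) : ℂ) * h v w + (t : ℂ) * k v w := rfl

theorem sesqMix_zero (h k : V →ₗ⋆[ℂ] V →ₗ[ℂ] ℂ) : sesqMix 0 h k = h := by
  simp [sesqMix]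

theorem sesqMix_one (h k : V →ₗ⋆[ℂ] V →ₗ[ℂ] ℂ) : sesqMix 1 h k = k := by
  simp [sesqMix]

end Forms


namespace HermMetric

open CVB

variable {Y : Type u} [TopologicalSpace Y]

/-- Over a paracompact Hausdorff space, hermitian structures on the trivial bundles `ℂ ^ rk i` are
patched together by a partition of unity. -/
theorem nonempty [NormalSpace Y] [ParacompactSpace Y] (E : CVB Y) : Nonempty (HermMetric E) := by
  obtain ⟨ρ, hρ⟩ := PartitionOfUnity.exists_isSubordinate (s := (Set.univ : Set Y)) isClosed_univ
    E.base E.isOpen_base fun y _ => Set.mem_iUnion.2 ⟨y, E.mem_base y⟩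
  -- the standard form of `ℂ ^ rk i`, pulled back by the trivialization with index `i`
  let g : ∀ (i y : Y), E.Fib y → E.Fib y → ℂ := fun i y v w =>
    ∑ l, starRingEnd ℂ (E.toModel i y v l) * E.toModel i y w l
  have gsymm : ∀ i y v w, starRingEnd ℂ (g i y v w) = g i y w v := fun i y v w => by
    simp only [g, map_sum, map_mul, Complex.conj_conj]
    exact Finset.sum_congr rfl fun l _ => mul_comm _ _
  have gself : ∀ i y v, g i y v v = ((∑ l, Complex.normSq (E.toModel i y v l) : ℝ) : ℂ) :=
    fun i y v => by
      simp only [g, Complex.ofReal_sum, Complex.normSq_eq_conj_mul_self]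
  have gpos : ∀ i, ∀ y ∈ E.base i, ∀ v, v ≠ 0 →
      0 < ∑ l, Complex.normSq (E.toModel i y v l) := by
    intro i y hy v hv
    refine Finset.sum_pos' (fun l _ => Complex.normSq_nonneg _) ?_
    by_contra! h
    refine hv ?_
    rw [← E.ofModel_toModel i y hy v]
    have : E.toModel i y v = 0 := funext fun l =>
      Complex.normSq_eq_zero.1 (le_antisymm (h l (Finset.mem_univ _)) (Complex.normSq_nonneg _))
    rw [this, map_zero]
  let F : ∀ y, E.Fib y →ₗ⋆[ℂ] E.Fib y →ₗ[ℂ] ℂ := fun y =>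
    LinearMap.mk₂'ₛₗ (starRingEnd ℂ) (RingHom.id ℂ)
      (fun v w => ∑ i ∈ ρ.finsupport y, (ρ i y : ℂ) * g i y v w)
      (fun v v' w => by
        simp only [g, map_add, Pi.add_apply, add_mul, Finset.sum_add_distrib, mul_add])
      (fun c v w => by
        simp only [g, map_smul, Pi.smul_apply, smul_eq_mul, map_mul, Finset.mul_sum]
        refine Finset.sum_congr rfl fun i _ => Finset.sum_congr rfl fun l _ => by ring)
      (fun v w w' => by
        simp only [g, map_add, Pi.add_apply, mul_add, Finset.sum_add_distrib])
      (fun c v w => by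
        simp only [g, map_smul, Pi.smul_apply, smul_eq_mul, Finset.mul_sum, RingHom.id_apply]
        refine Finset.sum_congr rfl fun i _ => Finset.sum_congr rfl fun l _ => by ring)
  refine ⟨⟨F, fun y v w => ?_, fun y v hv => ?_, fun k m m' => ?_⟩⟩
  · change starRingEnd ℂ (∑ i ∈ ρ.finsupport y, (ρ i y : ℂ) * g i y v w) =
      ∑ i ∈ ρ.finsupport y, (ρ i y : ℂ) * g i y w v
    simp only [map_sum, map_mul, Complex.conj_ofReal, gsymm]
  · change 0 < (∑ i ∈ ρ.finsupport y, (ρ i y : ℂ) * g i y v v).re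
    simp only [gself, ← Complex.ofReal_mul, ← Complex.ofReal_sum, Complex.ofReal_re]
    have hbase : ∀ i ∈ ρ.finsupport y, y ∈ E.base i ∧ 0 < ρ i y := fun i hi => by
      have h0 := (ρ.mem_finsupport y).1 hi
      exact ⟨hρ i (subset_tsupport _ h0), lt_of_le_of_ne (ρ.nonneg i y) (Ne.symm h0)⟩
    refine Finset.sum_pos (fun i hi => mul_pos (hbase i hi).2 (gpos i y (hbase i hi).1 v hv)) ?_
    rw [Finset.nonempty_iff_ne_empty]
    intro h
    have := ρ.sum_finsupport (Set.mem_univ y)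
    rw [h, Finset.sum_empty] at this
    exact zero_ne_one this
  · intro y₀ hy₀
    obtain ⟨I, N, hN, hNU, hNs⟩ := ρ.exists_finset_nhds_support_subset hρ E.isOpen_base y₀
    have hcont : ContinuousOn (fun y => ∑ i ∈ I, (ρ i y : ℂ) *
        g i y (E.ofModel k y m) (E.ofModel k y m')) (N ∩ E.base k) := by
      refine continuousOn_finsetSum _ fun i hi => ?_
      have hsub : N ∩ E.base k ⊆ E.base k ∩ E.base i := fun y hy =>
        ⟨hy.2, Set.mem_iInter₂.1 (hNU hy.1) i hi⟩
      have hc : ∀ m l, ContinuousOn (fun y => E.toModel i y (E.ofModel k y m) l)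
        (N ∩ E.base k) := fun m l => continuousOn_pi.1 ((E.continuousOn_transition k i m).mono hsub) l
      refine (Complex.continuous_ofReal.comp (ρ i).continuous).continuousOn.mul ?_
      exact continuousOn_finsetSum _ fun l _ =>
        (Complex.continuous_conj.comp_continuousOn (hc m l)).mul (hc m' l)
    have hmem : N ∩ E.base k ∈ nhds y₀ :=
      Filter.inter_mem hN ((E.isOpen_base k).mem_nhds hy₀)
    refine ContinuousAt.continuousWithinAt
      ((hcont.continuousAt hmem).congr (Filter.mem_of_superset hN fun y hy => ?_))
    refine (Finset.sum_subset (fun i hi => ?_) fun i _ hi => ?_).symm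
    · exact hNs y hy ((ρ.mem_finsupport y).1 hi)
    · have : ρ i y = 0 := by
        by_contra h
        exact hi ((ρ.mem_finsupport y).2 h)
      simp [this]

/-- The hermitian structure `(1 - t) h₀ + t h₁` over `Y × [0,1]`. -/
noncomputable def interpolate {E : CVB Y} (h₀ h₁ : HermMetric E) :
    HermMetric (E.pullback (fun p : Y × unitInterval => p.1) continuous_fst) where
  form p := sesqMix p.2 (h₀.form p.1) (h₁.form p.1)
  conj_symm p v w := by
    have e : ∀ v w : E.Fib p.1, starRingEnd ℂ (sesqMix p.2 (h₀.form p.1) (h₁.form p.1) v w) =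
        sesqMix p.2 (h₀.form p.1) (h₁.form p.1) w v := fun v w => by
      rw [sesqMix_apply, map_add, map_mul, map_mul, h₀.conj_symm, h₁.conj_symm,
        Complex.conj_ofReal, Complex.conj_ofReal, sesqMix_apply]
    exact e v w
  pos p v hv := by
    have h1 := h₀.pos p.1 v hv
    have h2 := h₁.pos p.1 v hv
    have h3 := p.2.2.1
    have h4 := p.2.2.2
    have e : ∀ v : E.Fib p.1, (sesqMix p.2 (h₀.form p.1) (h₁.form p.1) v v).re =
        (1 - p.2.1) * (h₀.form p.1 v v).re + p.2.1 * (h₁.form p.1 v v).re := fun v => by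
      rw [sesqMix_apply, Complex.add_re, Complex.re_ofReal_mul, Complex.re_ofReal_mul]
    refine lt_of_lt_of_eq ?_ (e v).symm
    rcases h3.eq_or_lt with h | h
    · rw [← h, sub_zero, one_mul, zero_mul, add_zero]
      exact h1
    · exact add_pos_of_nonneg_of_pos (mul_nonneg (sub_nonneg.2 h4) h1.le) (mul_pos h h2)
  cont i m m' := by
    have h1 : ContinuousOn (fun p : Y × unitInterval => h₀.form p.1 (E.ofModel i.1 p.1 m)
        (E.ofModel i.1 p.1 m')) _ := (h₀.cont i.1 m m').comp continuousOn_fst fun _ hp => hp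
    have h2 : ContinuousOn (fun p : Y × unitInterval => h₁.form p.1 (E.ofModel i.1 p.1 m)
        (E.ofModel i.1 p.1 m')) _ := (h₁.cont i.1 m m').comp continuousOn_fst fun _ hp => hp
    have h3 : Continuous fun p : Y × unitInterval => ((1 - p.2.1 : ℝ) : ℂ) := by fun_prop
    have h4 : Continuous fun p : Y × unitInterval => ((p.2.1 : ℝ) : ℂ) := by fun_prop
    exact (h3.continuousOn.mul h1).add (h4.continuousOn.mul h2)

/-- The orthogonal sum of hermitian structures. -/
noncomputable def sum {E F : CVB Y} (h : HermMetric E) (k : HermMetric F) :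
    HermMetric (E.sum F) where
  form y := sesqSum (h.form y) (k.form y)
  conj_symm y v w := by
    change starRingEnd ℂ (h.form y v.1 w.1 + k.form y v.2 w.2) =
      h.form y w.1 v.1 + k.form y w.2 v.2
    rw [map_add, h.conj_symm, k.conj_symm]
  pos y v hv := by
    change 0 < (h.form y v.1 v.1 + k.form y v.2 v.2).re
    rw [Complex.add_re]
    by_cases h1 : v.1 = 0
    · have h2 : v.2 ≠ 0 := fun h2 => hv (Prod.ext h1 h2)
      exact add_pos_of_nonneg_of_pos (h.form_self_re_nonneg y _) (k.pos y _ h2)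
    · exact add_pos_of_pos_of_nonneg (h.pos y _ h1) (k.form_self_re_nonneg y _)
  cont i m m' := by
    let e := (Module.finBasis ℂ ((Fin (E.rk i) → ℂ) × (Fin (F.rk i) → ℂ))).equivFun.symm
    exact ((h.cont i (e m).1 (e m').1).mono Set.inter_subset_left).add
      ((k.cont i (e m).2 (e m').2).mono Set.inter_subset_right)

/-- The hermitian structure induced by an isomorphism of bundles. -/
noncomputable def comap {E F : CVB Y} (h : HermMetric F) (a : ∀ y, E.Fib y ≃ₗ[ℂ] F.Fib y)
    (ha : IsCont E F fun y => (a y).toLinearMap) : HermMetric E where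
  form y := sesqComap (h.form y) (a y).toLinearMap
  conj_symm y v w := h.conj_symm y _ _
  pos y v hv := h.pos y (a y v) (by simpa using hv)
  cont i m m' := by
    intro y₀ hy₀
    have hmem : E.base i ∩ F.base y₀ ∈ nhds y₀ :=
      ((E.isOpen_base i).inter (F.isOpen_base y₀)).mem_nhds ⟨hy₀, F.mem_base y₀⟩
    exact ((h.continuousOn_form_sections Set.inter_subset_right (ha i y₀ m)
      (ha i y₀ m')).continuousAt hmem).continuousWithinAt

/-- Uniqueness of the adjoint. -/
theorem bundleAdjoint_eq {E F : CVB Y} (hE : HermMetric E) (hF : HermMetric F)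
    (σ : ∀ y, E.Fib y →ₗ[ℂ] F.Fib y) {y : Y} {w : F.Fib y} {u : E.Fib y}
    (hu : ∀ v, hE.form y u v = hF.form y w (σ y v)) : bundleAdjoint hE hF σ y w = u :=
  hE.eq_of_forall y fun v => by rw [bundleAdjoint_spec, hu]

end HermMetric

/-! ### The Thom homomorphism of a section with proper zeros -/

open CVB

section KTheory

variable {Y : Type u} [TopologicalSpace Y]

theorem K0.mk_eq_of_rel {a b : FreeAbelianGroup (Triple Y)} (h : K0Rel Y (a - b)) :
    (QuotientAddGroup.mk a : K0 Y) = QuotientAddGroup.mk b := by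
  rw [eq_comm, QuotientAddGroup.eq, neg_add_eq_sub]
  exact AddSubgroup.subset_closure h

theorem K0.mk_eq_of_iso {S T : Triple Y} (h : S.Iso T) : K0.mk S = K0.mk T :=
  K0.mk_eq_of_rel (K0Rel.iso S T h)

theorem K0.mk_slice (H : Triple (Y × unitInterval)) : K0.mk (H.slice 0) = K0.mk (H.slice 1) :=
  K0.mk_eq_of_rel (K0Rel.homotopy H)

theorem K0.mk_sum (S T : Triple Y) : K0.mk (S.sum T) = K0.mk S + K0.mk T :=
  K0.mk_eq_of_rel (K0Rel.sum S T)

theorem K0.mk_acyclic (S : Triple Y) (h : ∀ y, Function.Bijective (S.σ y)) : K0.mk S = 0 := by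
  have h0 : K0Rel Y (FreeAbelianGroup.of S - 0) := by
    rw [sub_zero]
    exact K0Rel.acyclic S h
  exact K0.mk_eq_of_rel h0

theorem K0.hom_ext {A : Type*} [AddCommGroup A] {φ ψ : K0 Y →+ A}
    (h : ∀ S, φ (K0.mk S) = ψ (K0.mk S)) : φ = ψ :=
  QuotientAddGroup.addMonoidHom_ext _ (FreeAbelianGroup.lift_ext _ _ h)

/-- The triple on `Y × [0,1]` which is constant in the direction of `[0,1]`. -/
def Triple.const (S : Triple Y) : Triple (Y × unitInterval) where
  E := S.E.pullback (fun p => p.1) continuous_fst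
  F := S.F.pullback (fun p => p.1) continuous_fst
  σ p := S.σ p.1
  isSymbol := by
    refine ⟨S.isSymbol.1.pullback continuous_fst, ?_⟩
    obtain ⟨C, hC, h⟩ := S.isSymbol.2
    exact ⟨C ×ˢ Set.univ, hC.prod isCompact_univ, fun p hp => h p.1 fun h' => hp ⟨h', trivial⟩⟩

/-- The restriction of a hermitian structure to `Y × {t}`. -/
def HermMetric.slice {E : CVB (Y × unitInterval)} (h : HermMetric E) (t : unitInterval) :
    HermMetric (E.pullback (fun y => (y, t)) (by fun_prop)) :=
  h.pullback _ _

theorem HermMetric.interpolate_slice_zero {E : CVB Y} (h₀ h₁ : HermMetric E) :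
    (h₀.interpolate h₁).slice 0 = h₀ :=
  HermMetric.ext (funext fun y => sesqMix_zero (h₀.form y) (h₁.form y))

theorem HermMetric.interpolate_slice_one {E : CVB Y} (h₀ h₁ : HermMetric E) :
    (h₀.interpolate h₁).slice 1 = h₁ :=
  HermMetric.ext (funext fun y => sesqMix_one (h₀.form y) (h₁.form y))

end KTheory

section Functoriality

variable {E F E' F' A B : Type*} [AddCommGroup E] [Module ℂ E] [AddCommGroup F] [Module ℂ F]
  [AddCommGroup E'] [Module ℂ E'] [AddCommGroup F'] [Module ℂ F']
  [AddCommGroup A] [Module ℂ A] [AddCommGroup B] [Module ℂ B]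

theorem sharp_naturality {σ : E →ₗ[ℂ] F} {σ' : F →ₗ[ℂ] E} {ρ : E' →ₗ[ℂ] F'}
    {ρ' : F' →ₗ[ℂ] E'} (τ : A →ₗ[ℂ] B) (τ' : B →ₗ[ℂ] A) {a : E →ₗ[ℂ] E'} {b : F →ₗ[ℂ] F'}
    (h : b ∘ₗ σ = ρ ∘ₗ a) (h' : a ∘ₗ σ' = ρ' ∘ₗ b) :
    (TensorProduct.map b LinearMap.id).prodMap (TensorProduct.map a LinearMap.id) ∘ₗ
        sharp σ σ' τ τ' = sharp ρ ρ' τ τ' ∘ₗ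
      (TensorProduct.map a LinearMap.id).prodMap (TensorProduct.map b LinearMap.id) := by
  have h1 : ∀ e, b (σ e) = ρ (a e) := fun e => DFunLike.congr_fun h e
  have h2 : ∀ f, a (σ' f) = ρ' (b f) := fun f => DFunLike.congr_fun h' f
  refine LinearMap.prod_ext ?_ ?_
  · refine TensorProduct.ext' fun e a => ?_
    simp [h1]
  · refine TensorProduct.ext' fun f b => ?_
    simp [h2]

end Functoriality

theorem prodCongr_tensorCongr_toLinearMap {E F E' F' A B : Type*} [AddCommGroup E]
    [Module ℂ E] [AddCommGroup F] [Module ℂ F] [AddCommGroup E'] [Module ℂ E'] [AddCommGroup F']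
    [Module ℂ F'] [AddCommGroup A] [Module ℂ A] [AddCommGroup B] [Module ℂ B]
    (a : E ≃ₗ[ℂ] E') (b : F ≃ₗ[ℂ] F') :
    (LinearEquiv.prodCongr (TensorProduct.congr a (LinearEquiv.refl ℂ A))
      (TensorProduct.congr b (LinearEquiv.refl ℂ B))).toLinearMap =
      (TensorProduct.map a.toLinearMap LinearMap.id).prodMap
        (TensorProduct.map b.toLinearMap LinearMap.id) := rfl

theorem CVB.IsCont.koszulCongr {Y : Type u} [TopologicalSpace Y] {E F E' F' : CVB Y}
    (V : CVB Y) {a : ∀ y, E.Fib y ≃ₗ[ℂ] E'.Fib y} {b : ∀ y, F.Fib y ≃ₗ[ℂ] F'.Fib y}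
    (ha : IsCont E E' fun y => (a y).toLinearMap) (hb : IsCont F F' fun y => (b y).toLinearMap) :
    IsCont (koszulDom E F V) (koszulDom E' F' V) fun y =>
      (LinearEquiv.prodCongr
        (TensorProduct.congr (a y) (LinearEquiv.refl ℂ ((V.ext 0).Fib y)))
        (TensorProduct.congr (b y) (LinearEquiv.refl ℂ ((V.ext 1).Fib y)))).toLinearMap := by
  have h := (ha.tensor (isCont_id (V.ext 0))).prodMap (hb.tensor (isCont_id (V.ext 1)))
  exact (funext fun y => prodCongr_tensorCongr_toLinearMap (A := (V.ext 0).Fib y)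
    (B := (V.ext 1).Fib y) (a y) (b y)) ▸ h

/-- The data from which a Thom homomorphism `K⁰(B) → K⁰(Z)` is built: a map `f : Z → B` and a
section `s` of a complex vector bundle `V` on `Z` such that `f` is proper on the zero set of `s`. The
case of a complex vector bundle `π : Z → B` is that of `f = π`, `V = π^*Z`, and the tautological
section. -/
structure ThomData (Z B : Type u) [TopologicalSpace Z] [TopologicalSpace B] where
  f : Z → B
  continuous_f : Continuous f
  V : CVB Z
  s : ∀ z, V.Fib z
  isContSection : V.IsContSection s
  proper : ∀ C : Set B, IsCompact C → ∃ C' : Set Z, IsCompact C' ∧ ∀ z, f z ∈ C → s z = 0 → z ∈ C'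

namespace ThomData

variable {Z B : Type u} [TopologicalSpace Z] [TopologicalSpace B]

/-- Thom data with the same bundle `V` are equal if their maps and sections are. -/
theorem ext_of_eq {f f' : Z → B} {hf : Continuous f} {hf' : Continuous f'} {V : CVB Z}
    {s s' : ∀ z, V.Fib z} {hs : V.IsContSection s} {hs' : V.IsContSection s'} {p p'}
    (h : f = f') (h' : s = s') : ThomData.mk f hf V s hs p = ThomData.mk f' hf' V s' hs' p' := by
  subst h h'
  rfl

/-- The triple `f^*σ ⊗ (∧_s + ι_s)` on `Z`. -/
noncomputable def triple (d : ThomData Z B) (S : Triple B) (hE : HermMetric S.E)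
    (hF : HermMetric S.F) (h : HermMetric d.V) : Triple Z where
  E := koszulDom (S.E.pullback d.f d.continuous_f) (S.F.pullback d.f d.continuous_f) d.V
  F := koszulDom (S.F.pullback d.f d.continuous_f) (S.E.pullback d.f d.continuous_f) d.V
  σ := koszulMap (fun z => S.σ (d.f z)) (hE.pullback _ _) (hF.pullback _ _) h d.s
  isSymbol := by
    refine ⟨isCont_koszulMap (S.isSymbol.1.pullback d.continuous_f) _ _ _ d.isContSection, ?_⟩
    obtain ⟨C, hC, hb⟩ := S.isSymbol.2
    obtain ⟨C', hC', h'⟩ := d.proper C hC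
    refine ⟨C', hC', fun z hz => bijective_koszulMap _ _ _ ?_⟩
    by_cases hs : d.s z = 0
    · exact Or.inl (hb _ fun hzC => hz (h' z hzC hs))
    · exact Or.inr hs

/-- The product of Thom data with the interval. -/
def prodInterval (d : ThomData Z B) : ThomData (Z × unitInterval) (B × unitInterval) where
  f p := (d.f p.1, p.2)
  continuous_f := (d.continuous_f.comp continuous_fst).prodMk continuous_snd
  V := d.V.pullback (fun p => p.1) continuous_fst
  s p := d.s p.1
  isContSection := d.isContSection.pullback continuous_fst
  proper C hC := by
    obtain ⟨C', hC', h⟩ := d.proper _ (hC.image continuous_fst)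
    exact ⟨C' ×ˢ Set.univ, hC'.prod isCompact_univ, fun p hp hs =>
      ⟨h p.1 ⟨_, hp, rfl⟩ hs, trivial⟩⟩

/-- The restriction of a homotopy of Thom data to `Z × {t}`. -/
def slice (d : ThomData (Z × unitInterval) B) (t : unitInterval) : ThomData Z B where
  f z := d.f (z, t)
  continuous_f := d.continuous_f.comp (by fun_prop)
  V := d.V.pullback (fun z => (z, t)) (by fun_prop)
  s z := d.s (z, t)
  isContSection := d.isContSection.pullback (by fun_prop)
  proper C hC := by
    obtain ⟨C', hC', h⟩ := d.proper C hC
    exact ⟨Prod.fst '' C', hC'.image continuous_fst, fun z hz hs => ⟨_, h (z, t) hz hs, rfl⟩⟩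

/-- A homotopy of triples on `B` induces one on `Z`; its restriction to `Z × {t}` is definitionally
the triple built from the restriction to `B × {t}`. -/
theorem mk_triple_slice (d : ThomData Z B) (H : Triple (B × unitInterval))
    (hE : HermMetric H.E) (hF : HermMetric H.F) (h : HermMetric d.prodInterval.V) :
    K0.mk (d.triple (H.slice 0) (hE.slice 0) (hF.slice 0) (h.slice 0)) =
      K0.mk (d.triple (H.slice 1) (hE.slice 1) (hF.slice 1) (h.slice 1)) :=
  K0.mk_slice (d.prodInterval.triple H hE hF h)

/-- The class does not depend on the hermitian structures, since any two are homotopic. -/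
theorem mk_triple_eq (d : ThomData Z B) (S : Triple B) (hE hE' : HermMetric S.E)
    (hF hF' : HermMetric S.F) (h h' : HermMetric d.V) :
    K0.mk (d.triple S hE hF h) = K0.mk (d.triple S hE' hF' h') := by
  have key := d.mk_triple_slice S.const (hE.interpolate hE') (hF.interpolate hF')
    (h.interpolate h')
  have e0 : d.triple (S.const.slice 0) ((hE.interpolate hE').slice 0)
      ((hF.interpolate hF').slice 0) ((h.interpolate h').slice 0) = d.triple S hE hF h := by
    exact congr (congrArg₂ (d.triple S) (hE.interpolate_slice_zero hE')
      (hF.interpolate_slice_zero hF')) (h.interpolate_slice_zero h')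
  have e1 : d.triple (S.const.slice 1) ((hE.interpolate hE').slice 1)
      ((hF.interpolate hF').slice 1) ((h.interpolate h').slice 1) = d.triple S hE' hF' h' :=
    congr (congrArg₂ (d.triple S) (hE.interpolate_slice_one hE')
      (hF.interpolate_slice_one hF')) (h.interpolate_slice_one h')
  rw [← e0, ← e1]
  exact key

/-- Isomorphic triples give isomorphic triples, for hermitian structures that correspond. -/
theorem iso_triple (d : ThomData Z B) {S T : Triple B} {a : ∀ y, S.E.Fib y ≃ₗ[ℂ] T.E.Fib y}
    {b : ∀ y, S.F.Fib y ≃ₗ[ℂ] T.F.Fib y} (ha : IsCont S.E T.E fun y => (a y).toLinearMap)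
    (hb : IsCont S.F T.F fun y => (b y).toLinearMap)
    (hab : ∀ y v, b y (S.σ y v) = T.σ y (a y v)) (hE : HermMetric T.E) (hF : HermMetric T.F)
    (h : HermMetric d.V) :
    (d.triple S (hE.comap a ha) (hF.comap b hb) h).Iso (d.triple T hE hF h) := by
  have hadj : ∀ y w, a y (bundleAdjoint (hE.comap a ha) (hF.comap b hb) S.σ y w) =
      bundleAdjoint hE hF T.σ y (b y w) := by
    intro y w
    refine (HermMetric.bundleAdjoint_eq _ _ _ fun v => ?_).symm
    obtain ⟨v, rfl⟩ := (a y).surjective v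
    rw [← hab]
    exact bundleAdjoint_spec (hE.comap a ha) (hF.comap b hb) S.σ y w v
  refine ⟨fun z => LinearEquiv.prodCongr
      (TensorProduct.congr (a (d.f z)) (LinearEquiv.refl ℂ _))
      (TensorProduct.congr (b (d.f z)) (LinearEquiv.refl ℂ _)),
    fun z => LinearEquiv.prodCongr
      (TensorProduct.congr (b (d.f z)) (LinearEquiv.refl ℂ _))
      (TensorProduct.congr (a (d.f z)) (LinearEquiv.refl ℂ _)), ?_, ?_, ?_⟩
  · exact IsCont.koszulCongr d.V (ha.pullback d.continuous_f) (hb.pullback d.continuous_f)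
  · exact IsCont.koszulCongr d.V (hb.pullback d.continuous_f) (ha.pullback d.continuous_f)
  · intro z v
    exact DFunLike.congr_fun (sharp_naturality (σ := S.σ (d.f z)) (ρ := T.σ (d.f z))
      (σ' := bundleAdjoint (hE.comap a ha) (hF.comap b hb) S.σ (d.f z))
      (ρ' := bundleAdjoint hE hF T.σ (d.f z))
      (thomFib (h.form z) (d.s z) 0 1 (by decide)) (thomFib (h.form z) (d.s z) 1 0 (by decide))
      (a := (a (d.f z)).toLinearMap) (b := (b (d.f z)).toLinearMap)
      (LinearMap.ext (hab (d.f z))) (LinearMap.ext (hadj (d.f z)))) v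

end ThomData

/-! ### Direct sums -/

section Algebra

variable {E F E' F' A B : Type*} [AddCommGroup E] [Module ℂ E] [AddCommGroup F] [Module ℂ F]
  [AddCommGroup E'] [Module ℂ E'] [AddCommGroup F'] [Module ℂ F']
  [AddCommGroup A] [Module ℂ A] [AddCommGroup B] [Module ℂ B]

variable (E F E' F' A B) in
/-- The distributivity isomorphism
`(E ⊕ E') ⊗ A ⊕ (F ⊕ F') ⊗ B ≅ (E ⊗ A ⊕ F ⊗ B) ⊕ (E' ⊗ A ⊕ F' ⊗ B)`. -/
noncomputable def sumTensorEquiv : (((E × E') ⊗[ℂ] A) × ((F × F') ⊗[ℂ] B)) ≃ₗ[ℂ]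
    (((E ⊗[ℂ] A) × (F ⊗[ℂ] B)) × ((E' ⊗[ℂ] A) × (F' ⊗[ℂ] B))) :=
  (LinearEquiv.prodCongr (TensorProduct.prodLeft ℂ ℂ E E' A) (TensorProduct.prodLeft ℂ ℂ F F' B)).trans
    (LinearEquiv.prodProdProdComm ℂ _ _ _ _)

theorem sumTensorEquiv_toLinearMap : (sumTensorEquiv E F E' F' A B).toLinearMap =
    ((TensorProduct.map (LinearMap.fst ℂ E E') LinearMap.id).prodMap
        (TensorProduct.map (LinearMap.fst ℂ F F') LinearMap.id)).prod
      ((TensorProduct.map (LinearMap.snd ℂ E E') LinearMap.id).prodMap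
        (TensorProduct.map (LinearMap.snd ℂ F F') LinearMap.id)) := by
  refine LinearMap.prod_ext ?_ ?_
  · refine TensorProduct.ext' fun ⟨e, e'⟩ a => ?_
    simp [sumTensorEquiv]
  · refine TensorProduct.ext' fun ⟨f, f'⟩ b => ?_
    simp [sumTensorEquiv]

theorem sumTensorEquiv_sharp (σ : E →ₗ[ℂ] F) (σ' : F →ₗ[ℂ] E) (ρ : E' →ₗ[ℂ] F')
    (ρ' : F' →ₗ[ℂ] E') (τ : A →ₗ[ℂ] B) (τ' : B →ₗ[ℂ] A) :
    (sumTensorEquiv F E F' E' A B).toLinearMap ∘ₗ sharp (σ.prodMap ρ) (σ'.prodMap ρ') τ τ' =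
      (sharp σ σ' τ τ').prodMap (sharp ρ ρ' τ τ') ∘ₗ
        (sumTensorEquiv E F E' F' A B).toLinearMap := by
  rw [sumTensorEquiv_toLinearMap, sumTensorEquiv_toLinearMap]
  refine LinearMap.prod_ext ?_ ?_
  · refine TensorProduct.ext' fun e a => ?_
    simp
  · refine TensorProduct.ext' fun f b => ?_
    simp

end Algebra

theorem CVB.isCont_sumTensorEquiv {Y : Type u} [TopologicalSpace Y] (E F E' F' V : CVB Y) :
    IsCont (koszulDom (E.sum E') (F.sum F') V) ((koszulDom E F V).sum (koszulDom E' F' V))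
      (fun y => (sumTensorEquiv (E.Fib y) (F.Fib y) (E'.Fib y) (F'.Fib y) ((V.ext 0).Fib y)
        ((V.ext 1).Fib y)).toLinearMap) := by
  have h := (((isCont_fst E E').tensor (isCont_id (V.ext 0))).prodMap
    ((isCont_fst F F').tensor (isCont_id (V.ext 1)))).prod
    (((isCont_snd E E').tensor (isCont_id (V.ext 0))).prodMap
      ((isCont_snd F F').tensor (isCont_id (V.ext 1))))
  exact (funext fun y => sumTensorEquiv_toLinearMap (E := E.Fib y) (F := F.Fib y)
    (E' := E'.Fib y) (F' := F'.Fib y) (A := (V.ext 0).Fib y) (B := (V.ext 1).Fib y)) ▸ h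

theorem HermMetric.bundleAdjoint_sum {Y : Type u} [TopologicalSpace Y] {E F E' F' : CVB Y}
    (hE : HermMetric E) (hF : HermMetric F) (hE' : HermMetric E') (hF' : HermMetric F')
    (σ : ∀ y, E.Fib y →ₗ[ℂ] F.Fib y) (ρ : ∀ y, E'.Fib y →ₗ[ℂ] F'.Fib y) (y : Y) :
    bundleAdjoint (hE.sum hE') (hF.sum hF') (fun y => (σ y).prodMap (ρ y)) y =
      (bundleAdjoint hE hF σ y).prodMap (bundleAdjoint hE' hF' ρ y) :=
  LinearMap.ext fun w => HermMetric.bundleAdjoint_eq _ _ _ fun v =>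
    congrArg₂ (· + ·) (bundleAdjoint_spec hE hF σ y w.1 v.1)
      (bundleAdjoint_spec hE' hF' ρ y w.2 v.2)

namespace ThomData

variable {Z B : Type u} [TopologicalSpace Z] [TopologicalSpace B]

theorem iso_triple_sum (d : ThomData Z B) {S T : Triple B} (hE : HermMetric S.E)
    (hF : HermMetric S.F) (hE' : HermMetric T.E) (hF' : HermMetric T.F) (h : HermMetric d.V) :
    (d.triple (S.sum T) (hE.sum hE') (hF.sum hF') h).Iso
      ((d.triple S hE hF h).sum (d.triple T hE' hF' h)) := by
  refine ⟨fun z => sumTensorEquiv (S.E.Fib (d.f z)) (S.F.Fib (d.f z)) (T.E.Fib (d.f z))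
      (T.F.Fib (d.f z)) ((d.V.ext 0).Fib z) ((d.V.ext 1).Fib z),
    fun z => sumTensorEquiv (S.F.Fib (d.f z)) (S.E.Fib (d.f z)) (T.F.Fib (d.f z))
      (T.E.Fib (d.f z)) ((d.V.ext 0).Fib z) ((d.V.ext 1).Fib z), ?_, ?_, ?_⟩
  · exact isCont_sumTensorEquiv (S.E.pullback d.f d.continuous_f) (S.F.pullback d.f d.continuous_f)
      (T.E.pullback d.f d.continuous_f) (T.F.pullback d.f d.continuous_f) d.V
  · exact isCont_sumTensorEquiv (S.F.pullback d.f d.continuous_f) (S.E.pullback d.f d.continuous_f)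
      (T.F.pullback d.f d.continuous_f) (T.E.pullback d.f d.continuous_f) d.V
  · intro z v
    have key := DFunLike.congr_fun (sumTensorEquiv_sharp (S.σ (d.f z))
      (bundleAdjoint hE hF S.σ (d.f z)) (T.σ (d.f z)) (bundleAdjoint hE' hF' T.σ (d.f z))
      (thomFib (h.form z) (d.s z) 0 1 (by decide)) (thomFib (h.form z) (d.s z) 1 0 (by decide))) v
    rw [← HermMetric.bundleAdjoint_sum hE hF hE' hF' S.σ T.σ (d.f z)] at key
    exact key

theorem bijective_triple (d : ThomData Z B) {S : Triple B} (hS : ∀ b, Function.Bijective (S.σ b))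
    (hE : HermMetric S.E) (hF : HermMetric S.F) (h : HermMetric d.V) (z : Z) :
    Function.Bijective ((d.triple S hE hF h).σ z) := by
  have := bijective_koszulMap (E := S.E.pullback d.f d.continuous_f)
    (F := S.F.pullback d.f d.continuous_f) (σ := fun z => S.σ (d.f z))
    (hE.pullback d.f d.continuous_f)
    (hF.pullback d.f d.continuous_f) h (s := d.s) (y := z) (Or.inl (hS (d.f z)))
  exact this

variable [T2Space B] [LocallyCompactSpace B] [SigmaCompactSpace B]

/-- The Thom homomorphism `[σ] ↦ [f^*σ ⊗ (∧_s + ι_s)]`. The hypotheses on `B` make `B` and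
`B × [0,1]` paracompact, so that all bundles on these spaces have hermitian structures. -/
noncomputable def thomHom (d : ThomData Z B) (h : HermMetric d.V) : K0 B →+ K0 Z :=
  QuotientAddGroup.lift _
    (FreeAbelianGroup.lift fun S : Triple B => K0.mk
      (d.triple S (HermMetric.nonempty S.E).some (HermMetric.nonempty S.F).some h)) (by
    refine (AddSubgroup.closure_le _).2 ?_
    intro x hx
    rw [SetLike.mem_coe, AddMonoidHom.mem_ker]
    induction hx with
    | iso S T hST =>
      obtain ⟨a, b, ha, hb, hab⟩ := hST
      rw [map_sub, FreeAbelianGroup.lift_apply_of, FreeAbelianGroup.lift_apply_of, sub_eq_zero,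
        ← K0.mk_eq_of_iso (d.iso_triple ha hb hab _ _ h)]
      exact d.mk_triple_eq ..
    | homotopy H =>
      obtain ⟨hE⟩ := HermMetric.nonempty H.E
      obtain ⟨hF⟩ := HermMetric.nonempty H.F
      rw [map_sub, FreeAbelianGroup.lift_apply_of, FreeAbelianGroup.lift_apply_of, sub_eq_zero]
      refine (d.mk_triple_eq ..).trans ((d.mk_triple_slice H hE hF
        (h.pullback _ continuous_fst)).trans (d.mk_triple_eq ..))
    | sum S T =>
      rw [map_sub, map_add, FreeAbelianGroup.lift_apply_of, FreeAbelianGroup.lift_apply_of,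
        FreeAbelianGroup.lift_apply_of, sub_eq_zero, ← K0.mk_sum,
        ← K0.mk_eq_of_iso (d.iso_triple_sum _ _ _ _ h)]
      exact d.mk_triple_eq ..
    | acyclic S hS =>
      rw [FreeAbelianGroup.lift_apply_of]
      exact K0.mk_acyclic _ (d.bijective_triple hS _ _ h))

theorem thomHom_mk (d : ThomData Z B) (h : HermMetric d.V) (S : Triple B) (hE : HermMetric S.E)
    (hF : HermMetric S.F) (h' : HermMetric d.V) :
    d.thomHom h (K0.mk S) = K0.mk (d.triple S hE hF h') :=
  (FreeAbelianGroup.lift_apply_of _ _).trans (d.mk_triple_eq ..)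

/-- Homotopic Thom data define the same Thom homomorphism. -/
theorem thomHom_slice (d : ThomData (Z × unitInterval) B) (h : HermMetric d.V)
    (h₀ : HermMetric (d.slice 0).V) (h₁ : HermMetric (d.slice 1).V) :
    (d.slice 0).thomHom h₀ = (d.slice 1).thomHom h₁ := by
  refine K0.hom_ext fun S => ?_
  obtain ⟨hE⟩ := HermMetric.nonempty S.E
  obtain ⟨hF⟩ := HermMetric.nonempty S.F
  rw [thomHom_mk _ _ S hE hF (h.slice 0), thomHom_mk _ _ S hE hF (h.slice 1)]
  exact K0.mk_slice (d.triple S hE hF h)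

theorem thomHom_congr {d d' : ThomData Z B} (e : d = d') (h : HermMetric d.V)
    (h' : HermMetric d'.V) : d.thomHom h = d'.thomHom h' := by
  subst e
  refine K0.hom_ext fun S => ?_
  obtain ⟨hE⟩ := HermMetric.nonempty S.E
  obtain ⟨hF⟩ := HermMetric.nonempty S.F
  rw [thomHom_mk _ _ S hE hF h, thomHom_mk _ _ S hE hF h]

end ThomData

/-! ### The Thom map of a complex vector bundle -/

namespace ComplexBundleOn

section Algebra

variable {Z B : Type u} [TopologicalSpace B] {π : Z → B} (W : ComplexBundleOn π)

variable {W} in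
/-- A fibre contains only one point at which the tautological section vanishes. -/
theorem taut_eq_zero_unique {z z' : Z} (h : π z = π z') (h0 : W.taut z = 0) (h0' : W.taut z' = 0) :
    z = z' := by
  have h1 : ∀ (b : B) (hb : π z' = b), W.fibEquiv b ⟨z', hb⟩ = 0 := by
    rintro _ rfl
    exact h0'
  have := (W.fibEquiv (π z)).injective (h0.trans (h1 (π z) h.symm).symm)
  exact congrArg Subtype.val this

/-- The zero section of a complex vector bundle. -/
noncomputable def zeroSection (b : B) : Z :=
  ((W.fibEquiv b).symm 0).1

theorem proj_zeroSection (b : B) : π (W.zeroSection b) = b := ((W.fibEquiv b).symm 0).2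

theorem taut_zeroSection (b : B) : W.taut (W.zeroSection b) = 0 := by
  have h1 : ∀ (b' : B) (hb : π (W.zeroSection b) = b'), b' = b →
      W.fibEquiv b' ⟨W.zeroSection b, hb⟩ = 0 := by
    rintro b' hb rfl
    exact (W.fibEquiv b').apply_symm_apply 0
  exact h1 _ rfl (W.proj_zeroSection b)

end Algebra

variable {Z B : Type u} [TopologicalSpace Z] [TopologicalSpace B] {π : Z → B}
  {W : ComplexBundleOn π}

theorem IsTopological.isContSection_taut (hW : W.IsTopological) (hπ : Continuous π) :
    (W.bundle.pullback π hπ).IsContSection W.taut := fun i =>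
  continuousOn_iff_continuous_domRestrict.2 (hW (π i)).continuous.snd

theorem IsTopological.continuous_zeroSection (hW : W.IsTopological) :
    Continuous W.zeroSection := by
  refine continuous_iff_continuousAt.2 fun b₀ => ?_
  obtain ⟨-, g, hgl, -, hg⟩ := isHomeomorph_iff_exists_inverse.1 (hW b₀)
  have h1 : Continuous fun b : W.bundle.base b₀ => (g (b, 0)).1 :=
    continuous_subtype_val.comp (hg.comp (by fun_prop))
  have h2 : ∀ b : W.bundle.base b₀, (g (b, 0)).1 = W.zeroSection b := by
    intro b
    have hm : π (W.zeroSection b) ∈ W.bundle.base b₀ := (W.proj_zeroSection b.1).symm ▸ b.2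
    have e : ((⟨π (W.zeroSection b), hm⟩ : W.bundle.base b₀),
        W.bundle.toModel b₀ (π (W.zeroSection b)) (W.taut (W.zeroSection b))) = (b, 0) :=
      Prod.ext (Subtype.ext (W.proj_zeroSection b.1)) (by rw [W.taut_zeroSection, map_zero])
    rw [← e]
    exact congrArg Subtype.val (hgl ⟨W.zeroSection b, hm⟩)
  have h3 : ContinuousOn W.zeroSection (W.bundle.base b₀) :=
    continuousOn_iff_continuous_domRestrict.2 (h1.congr h2)
  exact h3.continuousAt ((W.bundle.isOpen_base b₀).mem_nhds (W.bundle.mem_base b₀))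

/-- The Thom data of a complex vector bundle. -/
noncomputable def thomData (W : ComplexBundleOn π) (hπ : Continuous π) (hW : W.IsTopological) :
    ThomData Z B where
  f := π
  continuous_f := hπ
  V := W.bundle.pullback π hπ
  s := W.taut
  isContSection := hW.isContSection_taut hπ
  proper C hC := ⟨W.zeroSection '' C, hC.image hW.continuous_zeroSection, fun z hz hs =>
    ⟨π z, hz, taut_eq_zero_unique (W.proj_zeroSection _) (W.taut_zeroSection _) hs⟩⟩

/-- There is exactly one Thom map of `W`, namely the Thom homomorphism of its Thom data: the triples
`π^*σ ⊗ τ` are those of the Thom data, with the pull-back of a hermitian structure of `W`. -/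
theorem isThomMap_iff [T2Space B] [LocallyCompactSpace B] [SigmaCompactSpace B] (hπ : Continuous π)
    (hW : W.IsTopological) (h : HermMetric (W.thomData hπ hW).V) (φ : K0 B →+ K0 Z) :
    IsThomMap hπ W φ ↔ φ = (W.thomData hπ hW).thomHom h := by
  constructor
  · intro hφ
    refine K0.hom_ext fun S => ?_
    obtain ⟨hE⟩ := HermMetric.nonempty S.E
    obtain ⟨hF⟩ := HermMetric.nonempty S.F
    obtain ⟨k⟩ := HermMetric.nonempty W.bundle
    obtain ⟨hs, e⟩ := hφ S hE hF k
    rw [e, ThomData.thomHom_mk (W.thomData hπ hW) h S hE hF (k.pullback π hπ)]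
    rfl
  · rintro rfl S hE hF k
    exact ⟨((W.thomData hπ hW).triple S hE hF (k.pullback π hπ)).isSymbol,
      ThomData.thomHom_mk (W.thomData hπ hW) h S hE hF (k.pullback π hπ)⟩

end ComplexBundleOn

/-! ### The topology of the double tangent bundle -/

section DoubleTangent

open Bundle

variable {n : ℕ} {X : Type u} [TopologicalSpace X] [ChartedSpace (EuclideanSpace ℝ (Fin n)) X]
  [IsManifold (𝓡 n) ∞ X]

local notation "𝔼" => EuclideanSpace ℝ (Fin n)

/-- A linear combination of continuous families of tangent vectors is continuous. -/
theorem continuousAt_smul_add_smul {Q : Type*} [TopologicalSpace Q] {x : Q → X}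
    {a b : ∀ q, TangentSpace (𝓡 n) (x q)} {α β : Q → ℝ} {q₀ : Q}
    (ha : ContinuousAt (fun q => (⟨x q, a q⟩ : TX n X)) q₀)
    (hb : ContinuousAt (fun q => (⟨x q, b q⟩ : TX n X)) q₀)
    (hα : ContinuousAt α q₀) (hβ : ContinuousAt β q₀) :
    ContinuousAt (fun q => (⟨x q, α q • a q + β q • b q⟩ : TX n X)) q₀ := by
  rw [FiberBundle.continuousAt_totalSpace] at ha hb ⊢
  refine ⟨ha.1, ((hα.smul ha.2).add (hβ.smul hb.2)).congr ?_⟩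
  let t := trivializationAt 𝔼 (TangentSpace (𝓡 n) : X → Type) (x q₀)
  have hx : ∀ᶠ q in nhds q₀, x q ∈ t.baseSet :=
    ha.1.eventually_mem (t.open_baseSet.mem_nhds (FiberBundle.mem_baseSet_trivializationAt' (x q₀)))
  filter_upwards [hx] with q hq
  change α q • (t ⟨x q, a q⟩).2 + β q • (t ⟨x q, b q⟩).2 = (t ⟨x q, _⟩).2
  have h := fun v => congrFun (t.coe_linearMapAt_of_mem (R := ℝ) hq) v
  simp only [← h, map_add, map_smul]

namespace LinearConnection

variable (D : LinearConnection n X)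

/-- The vertical component `w_v`, as a map `T(TX) → TX`. -/
noncomputable def vert (w : TTX n X) : TX n X := ⟨w.proj.proj, D.K w.proj w.2⟩

theorem continuous_vert : Continuous D.vert := D.smooth.continuous

/-- The vector `w ∈ T(TX)` with `w_0 = a`, `w_h = b`, `w_v = c`. -/
noncomputable def assemble (x : X) (a b c : TangentSpace (𝓡 n) x) : TTX n X :=
  ⟨⟨x, a⟩, (Equiv.ofBijective _ (D.bijective ⟨x, a⟩)).symm (b, c)⟩

theorem mfderiv_assemble (x : X) (a b c : TangentSpace (𝓡 n) x) :
    (mfderiv (𝓡 n).tangent (𝓡 n) (TotalSpace.proj : TX n X → X) ⟨x, a⟩ (D.assemble x a b c).2,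
      D.K ⟨x, a⟩ (D.assemble x a b c).2) = (b, c) :=
  (Equiv.ofBijective _ (D.bijective ⟨x, a⟩)).apply_symm_apply (b, c)

theorem proj1_assemble (x : X) (a b c : TangentSpace (𝓡 n) x) :
    proj1 (D.assemble x a b c) = ⟨x, b⟩ :=
  congrArg (TotalSpace.mk x) (congrArg Prod.fst (D.mfderiv_assemble x a b c))

theorem vert_assemble (x : X) (a b c : TangentSpace (𝓡 n) x) :
    D.vert (D.assemble x a b c) = ⟨x, c⟩ :=
  congrArg (TotalSpace.mk x) (congrArg Prod.snd (D.mfderiv_assemble x a b c))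

theorem assemble_eq (w : TTX n X) :
    D.assemble w.proj.proj w.proj.2 (proj1 w).2 (D.vert w).2 = w :=
  congrArg (TotalSpace.mk w.proj)
    ((Equiv.ofBijective _ (D.bijective w.proj)).symm_apply_apply w.2)

/-- Continuous families `w_0`, `w_h`, `w_v` assemble to a continuous family in `T(TX)`: in local
trivializations, `w ↦ (w_h, w_v)` is an invertible linear map which depends continuously on `w_0`,
and so does its inverse. -/
theorem continuousAt_assemble {Q : Type*} [TopologicalSpace Q] {x : Q → X}
    {a b c : ∀ q, TangentSpace (𝓡 n) (x q)} {q₀ : Q}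
    (ha : ContinuousAt (fun q => (⟨x q, a q⟩ : TX n X)) q₀)
    (hb : ContinuousAt (fun q => (⟨x q, b q⟩ : TX n X)) q₀)
    (hc : ContinuousAt (fun q => (⟨x q, c q⟩ : TX n X)) q₀) :
    ContinuousAt (fun q => D.assemble (x q) (a q) (b q) (c q)) q₀ := by
  refine (FiberBundle.continuousAt_totalSpace (𝔼 × 𝔼) _).2 ⟨ha, ?_⟩
  let e := trivializationAt (𝔼 × 𝔼) (TangentSpace (𝓡 n).tangent : TX n X → Type) ⟨x q₀, a q₀⟩
  let t := trivializationAt 𝔼 (TangentSpace (𝓡 n) : X → Type) (x q₀)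
  let S : Set (TX n X) := e.baseSet ∩ TotalSpace.proj ⁻¹' t.baseSet
  have hSopen : IsOpen S := e.open_baseSet.inter
    (t.open_baseSet.preimage (FiberBundle.continuous_proj 𝔼 (TangentSpace (𝓡 n) : X → Type)))
  have hS₀ : (⟨x q₀, a q₀⟩ : TX n X) ∈ S :=
    ⟨FiberBundle.mem_baseSet_trivializationAt' _,
      show x q₀ ∈ t.baseSet from FiberBundle.mem_baseSet_trivializationAt' (x q₀)⟩
  -- the map `w ↦ (w_h, w_v)` on the fibre over `p`, in local trivializations
  let M : ∀ p : TX n X, (𝔼 × 𝔼) →L[ℝ] (𝔼 × 𝔼) := fun p =>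
    (((t.continuousLinearMapAt ℝ p.proj).comp
      (mfderiv (𝓡 n).tangent (𝓡 n) (TotalSpace.proj : TX n X → X) p)).prod
      ((t.continuousLinearMapAt ℝ p.proj).comp (D.K p))).comp (e.symmL ℝ p)
  have hM : ∀ p ∈ S, ∀ w : TangentSpace (𝓡 n).tangent p,
      M p (e ⟨p, w⟩).2 = ((t (proj1 ⟨p, w⟩)).2, (t (D.vert ⟨p, w⟩)).2) := by
    intro p hp w
    have h1 : e.symmL ℝ p (e ⟨p, w⟩).2 = w :=
      (e.symmL_apply hp.1 _).trans (e.symm_apply_apply_mk hp.1 w)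
    have h := fun v => congrFun (t.coe_linearMapAt_of_mem (R := ℝ) hp.2) v
    change (t.linearMapAt ℝ p.proj (mfderiv (𝓡 n).tangent (𝓡 n) _ p (e.symmL ℝ p (e ⟨p, w⟩).2)),
      t.linearMapAt ℝ p.proj (D.K p (e.symmL ℝ p (e ⟨p, w⟩).2))) = _
    rw [h1, h, h]
    rfl
  have hMcont : ContinuousOn M S := by
    refine continuousOn_clm_apply.2 fun u => ?_
    have hw : ContinuousOn (fun p : TX n X => (⟨p, e.symm p u⟩ : TTX n X)) S :=
      e.continuousOn_symm.comp (f := fun p : TX n X => (p, u)) (s := S)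
        (continuous_id.prodMk continuous_const).continuousOn fun p hp => ⟨hp.1, trivial⟩
    have ht : ∀ g : TTX n X → TX n X, Continuous g → (∀ w, (g w).proj = w.proj.proj) →
        ContinuousOn (fun p : TX n X => (t (g ⟨p, e.symm p u⟩)).2) S := fun g hg hgp =>
      continuous_snd.comp_continuousOn (t.continuousOn.comp (hg.comp_continuousOn hw) fun p hp => by
        rw [t.mem_source, hgp]
        exact hp.2)
    refine ((ht _ continuous_proj1 fun _ => rfl).prodMk
      (ht _ D.continuous_vert fun _ => rfl)).congr fun p hp => ?_
    have := hM p hp (e.symm p u)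
    rwa [e.apply_mk_symm hp.1] at this
  have hMinv : ∀ p ∈ S, ∃ L : (𝔼 × 𝔼) ≃L[ℝ] (𝔼 × 𝔼), (L : (𝔼 × 𝔼) →L[ℝ] (𝔼 × 𝔼)) = M p := by
    intro p hp
    have hinj : Function.Injective (M p).toLinearMap := by
      refine (injective_iff_map_eq_zero _).2 fun u hu => ?_
      have hu' : M p u = 0 := hu
      have h1 := hM p hp (e.symm p u)
      rw [e.apply_mk_symm hp.1, hu'] at h1
      have ht : ∀ v : TangentSpace (𝓡 n) p.proj, (t ⟨p.proj, v⟩).2 = 0 → v = 0 := by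
        intro v hv
        have h2 := t.symmₗ_linearMapAt (R := ℝ) hp.2 v
        have h3 : t.linearMapAt ℝ p.proj v = 0 :=
          (congrFun (t.coe_linearMapAt_of_mem (R := ℝ) hp.2) v).trans hv
        rw [h3, map_zero] at h2
        exact h2.symm
      have h3 := ht _ (congrArg Prod.fst h1).symm
      have h4 := ht _ (congrArg Prod.snd h1).symm
      have h5 : e.symm p u = 0 := (D.bijective p).1 (by
        refine Prod.ext ?_ ?_
        · exact h3.trans (map_zero _).symm
        · exact h4.trans (map_zero _).symm)
      have h6 := e.apply_mk_symm hp.1 u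
      rw [h5] at h6
      have h7 := congrFun (e.coe_linearMapAt_of_mem (R := ℝ) hp.1) 0
      rw [map_zero] at h7
      exact (congrArg Prod.snd h6).symm.trans h7.symm
    refine ⟨(LinearEquiv.ofInjectiveEndo _ hinj).toContinuousLinearEquiv, ?_⟩
    exact ContinuousLinearMap.ext fun _ => rfl
  let v : Q → 𝔼 × 𝔼 := fun q => ((t ⟨x q, b q⟩).2, (t ⟨x q, c q⟩).2)
  have hv : ContinuousAt v q₀ :=
    ((FiberBundle.continuousAt_totalSpace 𝔼 _).1 hb).2.prodMk
      ((FiberBundle.continuousAt_totalSpace 𝔼 _).1 hc).2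
  obtain ⟨L₀, hL₀⟩ := hMinv _ hS₀
  have hinv : ContinuousAt (fun q => (M ⟨x q, a q⟩).inverse) q₀ := by
    have h1 : ContinuousAt (ContinuousLinearMap.inverse : ((𝔼 × 𝔼) →L[ℝ] (𝔼 × 𝔼)) → _)
        (M ⟨x q₀, a q₀⟩) := hL₀ ▸ (contDiffAt_map_inverse (n := 0) L₀).continuousAt
    have h2 : ContinuousAt (fun q => M ⟨x q, a q⟩) q₀ :=
      (hMcont.continuousAt (hSopen.mem_nhds hS₀)).comp (f := fun q => (⟨x q, a q⟩ : TX n X)) ha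
    exact ContinuousAt.comp (f := fun q => M ⟨x q, a q⟩) h1 h2
  refine (hinv.clm_apply hv).congr ?_
  filter_upwards [ha.eventually_mem (hSopen.mem_nhds hS₀)] with q hq
  have h1 := hM _ hq (D.assemble (x q) (a q) (b q) (c q)).2
  have h2 : v q = M ⟨x q, a q⟩ (e (D.assemble (x q) (a q) (b q) (c q))).2 := by
    refine Eq.trans ?_ h1.symm
    exact Prod.ext (congrArg (fun z => (t z).2) (D.proj1_assemble (x q) (a q) (b q) (c q)).symm)
      (congrArg (fun z => (t z).2) (D.vert_assemble (x q) (a q) (b q) (c q)).symm)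
  obtain ⟨L, hL⟩ := hMinv _ hq
  rw [h2, ← hL, ContinuousLinearMap.inverse_equiv]
  exact L.symm_apply_apply _

end LinearConnection

end DoubleTangent

/-! ### Complex coordinates on the double tangent bundle -/

section ComplexCoordinates

variable {V W : Type*} [AddCommGroup V] [Module ℝ V] [AddCommGroup W] [Module ℝ W]

theorem complexVec_zero : complexVec (0 : V) 0 = 0 := by simp [complexVec]

theorem complexVec_eq_zero {a b : V} (h : complexVec a b = 0) : a = 0 ∧ b = 0 :=
  Prod.ext_iff.1 (complexVec_bijective.1 (a₁ := (a, b)) (a₂ := (0, 0)) (h.trans complexVec_zero.symm))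

theorem baseChange_complexVec (f : V →ₗ[ℝ] W) (a b : V) :
    f.baseChange ℂ (complexVec a b) = complexVec (f a) (f b) := by
  simp [complexVec]

variable (V) in
/-- The real linear isomorphism `(a, b) ↦ a + i b` from `V × V` to `ℂ ^ k`, where the second space is
identified with `V ⊗ ℂ` by a choice of a basis. -/
noncomputable def complexCoord [FiniteDimensional ℝ V] :
    (V × V) ≃ₗ[ℝ] (Fin (Module.finrank ℂ (ℂ ⊗[ℝ] V)) → ℂ) :=
  (LinearEquiv.ofBijective
    ((TensorProduct.mk ℝ ℂ V 1).coprod (TensorProduct.mk ℝ ℂ V Complex.I))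
    complexVec_bijective).trans
    ((Module.finBasis ℂ (ℂ ⊗[ℝ] V)).equivFun.restrictScalars ℝ)

end ComplexCoordinates

section DoubleTangent

open Bundle

variable {n : ℕ} {X : Type u} [TopologicalSpace X] [ChartedSpace (EuclideanSpace ℝ (Fin n)) X]
  [IsManifold (𝓡 n) ∞ X]

local notation "𝔼" => EuclideanSpace ℝ (Fin n)

local notation "τ" => trivializationAt (EuclideanSpace ℝ (Fin n)) (TangentSpace (𝓡 n))

theorem complexTangent_toModel (i x : X) (a b : TangentSpace (𝓡 n) x) :
    (complexTangent n X).toModel i x (complexVec a b) =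
      complexCoord 𝔼 ((τ i).linearMapAt ℝ x a, (τ i).linearMapAt ℝ x b) :=
  congrArg (Module.finBasis ℂ (ℂ ⊗[ℝ] 𝔼)).equivFun (baseChange_complexVec _ a b)

variable (n) in
/-- The tangent vector at `x` with coordinates `u` in the trivialization with index `i`. -/
noncomputable def tangentOfCoord (i x : X) (u : 𝔼) : TangentSpace (𝓡 n) x := (τ i).symmₗ ℝ x u

theorem complexTangent_toModel_tangentOfCoord {i x : X} (hx : x ∈ (τ i).baseSet)
    (m : Fin ((complexTangent n X).rk i) → ℂ) :
    (complexTangent n X).toModel i x (complexVec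
      (tangentOfCoord n i x ((complexCoord 𝔼).symm m).1)
      (tangentOfCoord n i x ((complexCoord 𝔼).symm m).2)) = m := by
  rw [complexTangent_toModel, tangentOfCoord, tangentOfCoord,
    Trivialization.linearMapAt_symmₗ _ hx, Trivialization.linearMapAt_symmₗ _ hx]
  exact (complexCoord 𝔼).apply_symm_apply m

theorem tangentOfCoord_toModel {i x : X} (hx : x ∈ (τ i).baseSet) (a b : TangentSpace (𝓡 n) x) :
    tangentOfCoord n i x ((complexCoord 𝔼).symm
      ((complexTangent n X).toModel i x (complexVec a b))).1 = a ∧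
    tangentOfCoord n i x ((complexCoord 𝔼).symm
      ((complexTangent n X).toModel i x (complexVec a b))).2 = b := by
  rw [complexTangent_toModel, LinearEquiv.symm_apply_apply]
  exact ⟨Trivialization.symmₗ_linearMapAt _ hx a, Trivialization.symmₗ_linearMapAt _ hx b⟩

theorem continuousAt_tangentOfCoord {Q : Type*} [TopologicalSpace Q] {i : X} {x : Q → X} {u : Q → 𝔼}
    {q₀ : Q} (hx : ContinuousAt x q₀) (hu : ContinuousAt u q₀) (hq : x q₀ ∈ (τ i).baseSet) :
    ContinuousAt (fun q => (⟨x q, tangentOfCoord n i (x q) (u q)⟩ : TX n X)) q₀ := by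
  have h1 : ContinuousAt (fun q => (⟨x q, (τ i).symm (x q) (u q)⟩ : TX n X)) q₀ :=
    ContinuousAt.comp (f := fun q => (x q, u q))
      ((τ i).continuousOn_symm.continuousAt
        (((τ i).open_baseSet.prod isOpen_univ).mem_nhds ⟨hq, trivial⟩)) (hx.prodMk hu)
  refine h1.congr ?_
  filter_upwards [hx.eventually_mem ((τ i).open_baseSet.mem_nhds hq)] with q hq'
  exact congrArg (TotalSpace.mk (x q)) ((τ i).symmₗ_apply (R := ℝ) hq' (u q)).symm

theorem continuousOn_complexTangent_toModel {Q : Type*} [TopologicalSpace Q] {x : Q → X}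
    {a b : ∀ q, TangentSpace (𝓡 n) (x q)}
    (ha : Continuous (fun q => (⟨x q, a q⟩ : TX n X)))
    (hb : Continuous (fun q => (⟨x q, b q⟩ : TX n X))) (i : X) :
    ContinuousOn (fun q => (complexTangent n X).toModel i (x q) (complexVec (a q) (b q)))
      (x ⁻¹' (τ i).baseSet) := by
  have hcoord : ∀ c : ∀ q, TangentSpace (𝓡 n) (x q), Continuous (fun q => (⟨x q, c q⟩ : TX n X)) →
      ContinuousOn (fun q => (τ i).linearMapAt ℝ (x q) (c q)) (x ⁻¹' (τ i).baseSet) := by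
    intro c hc
    refine (continuous_snd.comp_continuousOn ((τ i).continuousOn.comp hc.continuousOn
      fun q hq => (τ i).mem_source.2 hq)).congr fun q hq => ?_
    exact congrFun ((τ i).coe_linearMapAt_of_mem (R := ℝ) hq) (c q)
  have hΛ : Continuous (complexCoord 𝔼) :=
    LinearMap.continuous_of_finiteDimensional (complexCoord 𝔼).toLinearMap
  refine (hΛ.comp_continuousOn ((hcoord a ha).prodMk (hcoord b hb))).congr fun q _ => ?_
  exact complexTangent_toModel i (x q) (a q) (b q)

theorem continuous_complexCoord_symm : Continuous ((complexCoord 𝔼).symm) :=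
  LinearMap.continuous_of_finiteDimensional (complexCoord 𝔼).symm.toLinearMap

/-- The inverse of a local trivialization is built from `LinearConnection.assemble`. -/
theorem isTopological_complexBundle0 (D : LinearConnection n X) :
    (complexBundle0 D).IsTopological := by
  intro i
  let S : Set (TX n X) := TotalSpace.proj ⁻¹' (τ i.proj).baseSet
  have hb : ∀ p : S, p.1.proj ∈ (τ i.proj).baseSet := fun p => p.2
  let g : S × (Fin ((complexTangent n X).rk i.proj) → ℂ) → TTX n X := fun q =>
    D.assemble q.1.1.proj q.1.1.2
      (tangentOfCoord n i.proj q.1.1.proj ((complexCoord 𝔼).symm q.2).2)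
      (tangentOfCoord n i.proj q.1.1.proj ((complexCoord 𝔼).symm q.2).1)
  have hg : Continuous g := by
    refine continuous_iff_continuousAt.2 fun q₀ => ?_
    have hp : Continuous fun q : S × (Fin ((complexTangent n X).rk i.proj) → ℂ) => q.1.1 := by
      fun_prop
    have hx := (FiberBundle.continuous_proj 𝔼 (TangentSpace (𝓡 n) : X → Type)).comp hp
    have hm := (continuous_complexCoord_symm (n := n)).comp (continuous_snd
      (X := S) (Y := Fin ((complexTangent n X).rk i.proj) → ℂ))
    exact D.continuousAt_assemble hp.continuousAt
      (continuousAt_tangentOfCoord hx.continuousAt hm.snd.continuousAt (hb q₀.1))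
      (continuousAt_tangentOfCoord hx.continuousAt hm.fst.continuousAt (hb q₀.1))
  refine isHomeomorph_iff_exists_inverse.2 ⟨?_, fun q => ⟨g q, q.1.2⟩, ?_, ?_, ?_⟩
  · refine Continuous.prodMk
      ((continuous_proj0.comp continuous_subtype_val).subtype_mk _) ?_
    have h := continuousOn_complexTangent_toModel (n := n) (X := X) (Q := TTX n X)
      (x := fun w => w.proj.proj) (a := fun w => D.K w.proj w.2) (b := fun w => (proj1 w).2)
      D.continuous_vert continuous_proj1 i.proj
    exact continuousOn_iff_continuous_domRestrict.1 h
  · intro z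
    refine Subtype.ext ?_
    obtain ⟨h1, h2⟩ := tangentOfCoord_toModel (n := n) (i := i.proj) (x := z.1.proj.proj) z.2
      (D.K z.1.proj z.1.2) (proj1 z.1).2
    refine Eq.trans ?_ (D.assemble_eq z.1)
    exact congrArg₂ (D.assemble z.1.proj.proj z.1.proj.2) h2 h1
  · intro q
    refine Prod.ext rfl ?_
    have h1 := D.mfderiv_assemble q.1.1.proj q.1.1.2
      (tangentOfCoord n i.proj q.1.1.proj ((complexCoord 𝔼).symm q.2).2)
      (tangentOfCoord n i.proj q.1.1.proj ((complexCoord 𝔼).symm q.2).1)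
    refine Eq.trans ?_ (complexTangent_toModel_tangentOfCoord (hb q.1) q.2)
    exact congrArg ((complexTangent n X).toModel i.proj q.1.1.proj)
      (congrArg₂ complexVec (congrArg Prod.snd h1) (congrArg Prod.fst h1))
  · exact hg.subtype_mk _

theorem isTopological_complexBundle1 (D : LinearConnection n X) :
    (complexBundle1 D).IsTopological := by
  intro i
  let S : Set (TX n X) := TotalSpace.proj ⁻¹' (τ i.proj).baseSet
  have hb : ∀ p : S, p.1.proj ∈ (τ i.proj).baseSet := fun p => p.2
  let g : S × (Fin ((complexTangent n X).rk i.proj) → ℂ) → TTX n X := fun q =>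
    D.assemble q.1.1.proj
      (tangentOfCoord n i.proj q.1.1.proj ((complexCoord 𝔼).symm q.2).1) q.1.1.2
      (tangentOfCoord n i.proj q.1.1.proj ((complexCoord 𝔼).symm q.2).2)
  have hg : Continuous g := by
    refine continuous_iff_continuousAt.2 fun q₀ => ?_
    have hp : Continuous fun q : S × (Fin ((complexTangent n X).rk i.proj) → ℂ) => q.1.1 := by
      fun_prop
    have hx := (FiberBundle.continuous_proj 𝔼 (TangentSpace (𝓡 n) : X → Type)).comp hp
    have hm := (continuous_complexCoord_symm (n := n)).comp (continuous_snd
      (X := S) (Y := Fin ((complexTangent n X).rk i.proj) → ℂ))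
    exact D.continuousAt_assemble
      (continuousAt_tangentOfCoord hx.continuousAt hm.fst.continuousAt (hb q₀.1)) hp.continuousAt
      (continuousAt_tangentOfCoord hx.continuousAt hm.snd.continuousAt (hb q₀.1))
  refine isHomeomorph_iff_exists_inverse.2 ⟨?_, fun q => ⟨g q, ?_⟩, ?_, ?_, ?_⟩
  · refine Continuous.prodMk
      ((continuous_proj1.comp continuous_subtype_val).subtype_mk _) ?_
    have h := continuousOn_complexTangent_toModel (n := n) (X := X) (Q := TTX n X)
      (x := fun w => w.proj.proj) (a := fun w => w.proj.2) (b := fun w => D.K w.proj w.2)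
      continuous_proj0 D.continuous_vert i.proj
    exact continuousOn_iff_continuous_domRestrict.1 h
  · exact q.1.2
  · intro z
    refine Subtype.ext ?_
    obtain ⟨h1, h2⟩ := tangentOfCoord_toModel (n := n) (i := i.proj) (x := z.1.proj.proj) z.2
      z.1.proj.2 (D.K z.1.proj z.1.2)
    refine Eq.trans ?_ (D.assemble_eq z.1)
    exact congrArg₂ (fun a c => D.assemble z.1.proj.proj a (proj1 z.1).2 c) h1 h2
  · intro q
    refine Prod.ext (Subtype.ext (D.proj1_assemble ..)) ?_
    have h1 := D.mfderiv_assemble q.1.1.proj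
      (tangentOfCoord n i.proj q.1.1.proj ((complexCoord 𝔼).symm q.2).1) q.1.1.2
      (tangentOfCoord n i.proj q.1.1.proj ((complexCoord 𝔼).symm q.2).2)
    refine Eq.trans ?_ (complexTangent_toModel_tangentOfCoord (hb q.1) q.2)
    exact congrArg ((complexTangent n X).toModel i.proj q.1.1.proj)
      (congrArg (complexVec _) (congrArg Prod.snd h1))
  · exact hg.subtype_mk _

end DoubleTangent

/-! ### The homotopy between the two bundle structures -/

section Homotopy

open Bundle

variable {n : ℕ} {X : Type u} [TopologicalSpace X] [ChartedSpace (EuclideanSpace ℝ (Fin n)) X]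
  [IsManifold (𝓡 n) ∞ X]

instance t2Space_TX [T2Space X] : T2Space (TX n X) := by
  refine ⟨fun p q hpq => ?_⟩
  have hproj := FiberBundle.continuous_proj (EuclideanSpace ℝ (Fin n))
    (TangentSpace (𝓡 n) : X → Type)
  by_cases h : p.proj = q.proj
  · let t := trivializationAt (EuclideanSpace ℝ (Fin n)) (TangentSpace (𝓡 n) : X → Type) p.proj
    have hp : p ∈ t.source := t.mem_source.2 (FiberBundle.mem_baseSet_trivializationAt' p.proj)
    have hq : q ∈ t.source :=
      t.mem_source.2 (h ▸ FiberBundle.mem_baseSet_trivializationAt' p.proj)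
    obtain ⟨U, V, hU, hV, hpU, hqV, hUV⟩ := t2_separation fun e => hpq (t.injOn hp hq e)
    exact ⟨t.source ∩ t ⁻¹' U, t.source ∩ t ⁻¹' V,
      t.continuousOn.isOpen_inter_preimage t.open_source hU,
      t.continuousOn.isOpen_inter_preimage t.open_source hV, ⟨hp, hpU⟩, ⟨hq, hqV⟩,
      (hUV.preimage t).mono Set.inter_subset_right Set.inter_subset_right⟩
  · exact separated_by_continuous hproj h

instance locallyCompactSpace_TX : LocallyCompactSpace (TX n X) :=
  Manifold.locallyCompact_of_finiteDimensional (𝓡 n).tangent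

instance sigmaCompactSpace_TX [CompactSpace X] : SigmaCompactSpace (TX n X) := by
  obtain ⟨s, hs⟩ := isCompact_univ.elim_finite_subcover
    (fun x : X => (chartAt (EuclideanSpace ℝ (Fin n)) x).source)
    (fun x => (chartAt (EuclideanSpace ℝ (Fin n)) x).open_source)
    (fun x _ => Set.mem_iUnion.2 ⟨x, mem_chart_source _ x⟩)
  have hc : ⋃ p ∈ (fun x : X => (⟨x, 0⟩ : TX n X)) '' (s : Set X),
      (chartAt (ModelProd (EuclideanSpace ℝ (Fin n)) (EuclideanSpace ℝ (Fin n))) p).source =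
        Set.univ := by
    refine Set.eq_univ_of_forall fun p => ?_
    obtain ⟨x, hx, hpx⟩ := Set.mem_iUnion₂.1 (hs (Set.mem_univ p.proj))
    exact Set.mem_iUnion₂.2 ⟨⟨x, 0⟩, ⟨x, hx, rfl⟩, (TangentBundle.mem_chart_source_iff _ _).2 hpx⟩
  have : SecondCountableTopology (ModelProd (EuclideanSpace ℝ (Fin n))
      (EuclideanSpace ℝ (Fin n))) :=
    inferInstanceAs (SecondCountableTopology (EuclideanSpace ℝ (Fin n) × EuclideanSpace ℝ (Fin n)))
  have : SecondCountableTopology (TX n X) :=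
    ChartedSpace.secondCountable_of_countable_cover _ hc (s.finite_toSet.image _).countable
  infer_instance

theorem isContSection_complexVec {Q : Type u} [TopologicalSpace Q] {x : Q → X} (hx : Continuous x)
    {a b : ∀ q, TangentSpace (𝓡 n) (x q)}
    (ha : Continuous (fun q => (⟨x q, a q⟩ : TX n X)))
    (hb : Continuous (fun q => (⟨x q, b q⟩ : TX n X))) :
    ((complexTangent n X).pullback x hx).IsContSection (fun q => complexVec (a q) (b q)) :=
  fun i => continuousOn_complexTangent_toModel ha hb (x i)

theorem continuous_smul_add_smul {Q : Type*} [TopologicalSpace Q] {x : Q → X}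
    {a b : ∀ q, TangentSpace (𝓡 n) (x q)} {α β : Q → ℝ}
    (ha : Continuous (fun q => (⟨x q, a q⟩ : TX n X)))
    (hb : Continuous (fun q => (⟨x q, b q⟩ : TX n X))) (hα : Continuous α) (hβ : Continuous β) :
    Continuous (fun q => (⟨x q, α q • a q + β q • b q⟩ : TX n X)) :=
  continuous_iff_continuousAt.2 fun _ => continuousAt_smul_add_smul ha.continuousAt
    hb.continuousAt hα.continuousAt hβ.continuousAt

theorem cyclic_det_ne_zero (t : ℝ) : (1 - t) ^ 3 + t ^ 3 ≠ 0 := by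
  have : (1 - t) ^ 3 + t ^ 3 = 3 * (t - 1 / 2) ^ 2 + 1 / 4 := by ring
  rw [this]
  positivity

/-- The matrix `(1 - t) I + t C`, where `C` is a cyclic permutation of three coordinates, is
invertible, because its determinant `(1 - t)³ + t³` does not vanish for real `t`. This solves the
system for the right hand side `(p, 0, 0)`. -/
theorem cyclic_solution {V : Type*} [AddCommGroup V] [Module ℝ V] {t : ℝ} {a b c p : V}
    (h1 : (1 - t) • a + t • b = p) (h2 : (1 - t) • c + t • a = 0)
    (h3 : (1 - t) • b + t • c = 0) :
    ((1 - t) ^ 2 / ((1 - t) ^ 3 + t ^ 3)) • p = a ∧ (t ^ 2 / ((1 - t) ^ 3 + t ^ 3)) • p = b ∧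
      (-((1 - t) * t) / ((1 - t) ^ 3 + t ^ 3)) • p = c := by
  have hδ := cyclic_det_ne_zero t
  set δ := (1 - t) ^ 3 + t ^ 3 with hδ'
  have key : ∀ (r : ℝ) (v : V), r • p = δ • v → (r / δ) • p = v := fun r v h => by
    rw [div_eq_inv_mul, mul_smul, h, smul_smul, inv_mul_cancel₀ hδ, one_smul]
  refine ⟨key _ _ ?_, key _ _ ?_, key _ _ ?_⟩
  · rw [← h1, hδ']
    linear_combination (norm := module) (t * (1 - t)) • h3 - t ^ 2 • h2
  · rw [← h1, hδ']
    linear_combination (norm := module) ((1 - t) * t) • h2 - (1 - t) ^ 2 • h3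
  · rw [← h1, hδ']
    linear_combination (norm := module) -(1 - t) ^ 2 • h2 - t ^ 2 • h3

/-- The point `w_0`, as a vector in the tangent space of `X`. -/
def baseVec (w : TTX n X) : TangentSpace (𝓡 n) w.proj.proj := w.proj.2

/-- The horizontal component `w_h`. -/
noncomputable def horizVec (w : TTX n X) : TangentSpace (𝓡 n) w.proj.proj := (proj1 w).2

/-- The vertical component `w_v`. -/
noncomputable def LinearConnection.vertVec (D : LinearConnection n X) (w : TTX n X) :
    TangentSpace (𝓡 n) w.proj.proj := D.K w.proj w.2

/-- The zeros of the homotopy over a compact set of base points form a compact set: they are the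
solutions of a linear system that depend continuously on the base point and the time. -/
theorem LinearConnection.exists_isCompact_of_zeros (D : LinearConnection n X) {C : Set (TX n X)}
    (hC : IsCompact C) : ∃ C' : Set (TTX n X × unitInterval), IsCompact C' ∧
      ∀ (w : TTX n X) (t : unitInterval),
        (⟨w.proj.proj, (1 - t.1) • baseVec w + t.1 • horizVec w⟩ : TX n X) ∈ C →
        (1 - t.1) • D.vertVec w + t.1 • baseVec w = 0 →
        (1 - t.1) • horizVec w + t.1 • D.vertVec w = 0 → (w, t) ∈ C' := by
  let α : ℝ → ℝ := fun t => (1 - t) ^ 2 / ((1 - t) ^ 3 + t ^ 3)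
  let β : ℝ → ℝ := fun t => t ^ 2 / ((1 - t) ^ 3 + t ^ 3)
  let γ : ℝ → ℝ := fun t => -((1 - t) * t) / ((1 - t) ^ 3 + t ^ 3)
  have hα : Continuous α := Continuous.div (by fun_prop) (by fun_prop) cyclic_det_ne_zero
  have hβ : Continuous β := Continuous.div (by fun_prop) (by fun_prop) cyclic_det_ne_zero
  have hγ : Continuous γ := Continuous.div (by fun_prop) (by fun_prop) cyclic_det_ne_zero
  have hsmul : ∀ r : ℝ → ℝ, Continuous r →
      Continuous fun q : TX n X × unitInterval => (⟨q.1.proj, r q.2.1 • q.1.2⟩ : TX n X) := by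
    intro r hr
    have h := continuous_smul_add_smul (n := n) (X := X)
      (x := fun q : TX n X × unitInterval => q.1.proj)
      (a := fun q => q.1.2) (b := fun q => q.1.2) continuous_fst continuous_fst
      (hr.comp (continuous_subtype_val.comp continuous_snd)) (continuous_const (y := (0 : ℝ)))
    simpa only [zero_smul, add_zero, Function.comp_apply] using h
  -- the zero over the base point `p` at the time `t`
  let g : TX n X × unitInterval → TTX n X × unitInterval := fun q =>
    (D.assemble q.1.proj (α q.2.1 • q.1.2) (β q.2.1 • q.1.2) (γ q.2.1 • q.1.2), q.2)
  have hg : Continuous g :=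
    (continuous_iff_continuousAt.2 fun q₀ => D.continuousAt_assemble (hsmul α hα).continuousAt
      (hsmul β hβ).continuousAt (hsmul γ hγ).continuousAt).prodMk continuous_snd
  refine ⟨g '' (C ×ˢ Set.univ), (hC.prod isCompact_univ).image hg, fun w t hw h2 h3 => ?_⟩
  refine ⟨(_, t), ⟨hw, trivial⟩, Prod.ext ?_ rfl⟩
  obtain ⟨e1, e2, e3⟩ := cyclic_solution (t := t.1) rfl h2 h3
  exact (congr (congrArg₂ (D.assemble w.proj.proj) e1 e2) e3).trans (D.assemble_eq w)

/-- Over `t ∈ [0,1]`, the vector `w` of `T(TX)` with components `(w_0, w_v, w_h)` is sent to the base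
point `(1 - t) w_0 + t w_h` and to the vector
`((1 - t) w_v + t w_0) + i ((1 - t) w_h + t w_v)`. -/
noncomputable def LinearConnection.thomHomotopy (D : LinearConnection n X) :
    ThomData (TTX n X × unitInterval) (TX n X) where
  f q := ⟨q.1.proj.proj, (1 - q.2.1) • baseVec q.1 + q.2.1 • horizVec q.1⟩
  continuous_f := continuous_smul_add_smul (x := fun q : TTX n X × unitInterval => q.1.proj.proj)
    (a := fun q => baseVec q.1) (b := fun q => horizVec q.1)
    (continuous_proj0.comp continuous_fst) (continuous_proj1.comp continuous_fst)
    (α := fun q => 1 - q.2.1) (β := fun q => q.2.1) (by fun_prop) (by fun_prop)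
  V := (complexTangent n X).pullback (fun q => q.1.proj.proj)
    ((FiberBundle.continuous_proj (EuclideanSpace ℝ (Fin n)) (TangentSpace (𝓡 n) : X → Type)).comp
      (continuous_proj0.comp continuous_fst))
  s q := complexVec ((1 - q.2.1) • D.vertVec q.1 + q.2.1 • baseVec q.1)
    ((1 - q.2.1) • horizVec q.1 + q.2.1 • D.vertVec q.1)
  isContSection := isContSection_complexVec (Q := TTX n X × unitInterval) _
    (continuous_smul_add_smul (x := fun q : TTX n X × unitInterval => q.1.proj.proj)
      (a := fun q => D.vertVec q.1) (b := fun q => baseVec q.1)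
      (D.continuous_vert.comp continuous_fst) (continuous_proj0.comp continuous_fst)
      (α := fun q => 1 - q.2.1) (β := fun q => q.2.1) (by fun_prop) (by fun_prop))
    (continuous_smul_add_smul (x := fun q : TTX n X × unitInterval => q.1.proj.proj)
      (a := fun q => horizVec q.1) (b := fun q => D.vertVec q.1)
      (continuous_proj1.comp continuous_fst) (D.continuous_vert.comp continuous_fst)
      (α := fun q => 1 - q.2.1) (β := fun q => q.2.1) (by fun_prop) (by fun_prop))
  proper C hC := by
    obtain ⟨C', hC', h⟩ := D.exists_isCompact_of_zeros hC
    exact ⟨C', hC', fun q hq hs => h q.1 q.2 hq (complexVec_eq_zero hs).1 (complexVec_eq_zero hs).2⟩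

variable (D : LinearConnection n X)

/-- At `t = 0` the homotopy is the bundle `π₀`, up to the definitional unfolding of its tautological
section `w_v + i w_h`. -/
theorem thomHomotopy_slice_zero : D.thomHomotopy.slice 0 =
    (complexBundle0 D).thomData continuous_proj0 (isTopological_complexBundle0 D) := by
  refine ThomData.ext_of_eq (Z := TTX n X) (B := TX n X) (funext fun w => ?_) (funext fun w => ?_)
  · change (⟨w.proj.proj, (1 - (0 : ℝ)) • baseVec w + (0 : ℝ) • horizVec w⟩ : TX n X) = w.proj
    rw [sub_zero, one_smul, zero_smul, add_zero]
    rfl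
  · change complexVec ((1 - (0 : ℝ)) • D.vertVec w + (0 : ℝ) • baseVec w)
      ((1 - (0 : ℝ)) • (horizVec w) + (0 : ℝ) • D.vertVec w) = complexVec (D.vertVec w) (horizVec w)
    rw [sub_zero, one_smul, zero_smul, add_zero, one_smul, zero_smul, add_zero]

/-- At `t = 1` the homotopy is the bundle `π₁`, with the tautological section `w_0 + i w_v`. -/
theorem thomHomotopy_slice_one : D.thomHomotopy.slice 1 =
    (complexBundle1 D).thomData continuous_proj1 (isTopological_complexBundle1 D) := by
  refine ThomData.ext_of_eq (Z := TTX n X) (B := TX n X) (funext fun w => ?_) (funext fun w => ?_)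
  · change (⟨w.proj.proj, (1 - (1 : ℝ)) • baseVec w + (1 : ℝ) • horizVec w⟩ : TX n X) =
      ⟨w.proj.proj, (proj1 w).2⟩
    rw [sub_self, one_smul, zero_smul, zero_add]
    rfl
  · change complexVec ((1 - (1 : ℝ)) • D.vertVec w + (1 : ℝ) • baseVec w)
      ((1 - (1 : ℝ)) • (horizVec w) + (1 : ℝ) • D.vertVec w) = complexVec (baseVec w) (D.vertVec w)
    rw [sub_self, one_smul, zero_smul, zero_add, one_smul, zero_smul, zero_add]

end Homotopy

theorem mainTheorem3 {n : ℕ} {X : Type u} [TopologicalSpace X] [T2Space X] [CompactSpace X]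
    [ChartedSpace (EuclideanSpace ℝ (Fin n)) X] [IsManifold (𝓡 n) ∞ X]
    (D : LinearConnection n X) :
    (complexBundle0 D).IsTopological ∧ (complexBundle1 D).IsTopological ∧
    ∃ Th : K0 (TX n X) →+ K0 (TTX n X),
      (∀ φ : K0 (TX n X) →+ K0 (TTX n X),
        IsThomMap continuous_proj0 (complexBundle0 D) φ ↔ φ = Th) ∧
      (∀ φ : K0 (TX n X) →+ K0 (TTX n X),
        IsThomMap continuous_proj1 (complexBundle1 D) φ ↔ φ = Th) := by
  have h0 := isTopological_complexBundle0 D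
  have h1 := isTopological_complexBundle1 D
  obtain ⟨k⟩ := HermMetric.nonempty (complexTangent n X)
  have hc : Continuous fun w : TTX n X => w.proj.proj := (FiberBundle.continuous_proj
    (EuclideanSpace ℝ (Fin n)) (TangentSpace (𝓡 n) : X → Type)).comp continuous_proj0
  let k0 : HermMetric ((complexBundle0 D).thomData continuous_proj0 h0).V := k.pullback _ hc
  let k1 : HermMetric ((complexBundle1 D).thomData continuous_proj1 h1).V := k.pullback _ hc
  have key : ((complexBundle0 D).thomData continuous_proj0 h0).thomHom k0 =
      ((complexBundle1 D).thomData continuous_proj1 h1).thomHom k1 := by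
    let l : HermMetric D.thomHomotopy.V := k.pullback _ (hc.comp continuous_fst)
    let l0 : HermMetric (D.thomHomotopy.slice 0).V := l.slice 0
    let l1 : HermMetric (D.thomHomotopy.slice 1).V := l.slice 1
    have e : (D.thomHomotopy.slice 0).thomHom l0 = (D.thomHomotopy.slice 1).thomHom l1 :=
      D.thomHomotopy.thomHom_slice l l0 l1
    have e0 := ThomData.thomHom_congr (thomHomotopy_slice_zero D) l0 k0
    have e1 := ThomData.thomHom_congr (thomHomotopy_slice_one D) l1 k1
    exact e0.symm.trans (e.trans e1)
  exact ⟨h0, h1, _, fun φ => ComplexBundleOn.isThomMap_iff continuous_proj0 h0 k0 φ, fun φ => by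
    rw [key]
    exact ComplexBundleOn.isThomMap_iff continuous_proj1 h1 k1 φ⟩
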